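/- All graphs are finite and simple. A graph is *distance hereditary* (DH) if in every connected induced subgraph the distance between any two vertices is the same as in the whole graph. A *split* of a graph $H$ is a bipartition $(V_1,V_2)$ of $V(H)$ with $|V_1|,|V_2|\ge 2$ such that every vertex of $N(V_1)$ is adjacent to every vertex of $N(V_2)$, where $N(S)$ is the set of vertices outside $S$ with a neighbour in $S$. The graph $H$ is *prime* if it has no split, and *degenerate* if every bipartition of $V(H)$ into two parts of size at least $2$ is a split. A *graph-labelled tree* $(T,\mathcal F)$ is a tree $T$ in which each node (non-leaf vertex) $v$ of degree $k$ is labelled by a graph $G_v\in\mathcal F$ on $k$ vertices, with a bijection $\rho_v$ from the tree-edges incident to $v$ to the vertices of $G_v$. Its *accessibility graph* has the leaves of $T$ as vertices, two distinct leaves $x,y$ being adjacent if and only if $\rho_v(e)\rho_v(e')\in E(G_v)$ for any two distinct tree-edges $e,e'$ with a common end $v$ on the path of $T$ between $x$ and $y$. The graph-labelled tree is *reduced* if every node has degree at least $3$, no two adjacent nodes are both labelled by cliques, and there is no tree-edge $uv$ between two nodes labelled by stars such that $\rho_u(uv)$ is the centre of $G_u$ and $\rho_v(uv)$ is not the centre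 of $G_v$. The *split tree* $ST(G)$ of a connected graph $G$ is the reduced graph-labelled tree with accessibility graph $G$ all of whose labels are prime or degenerate. **Theorem.** Let $G$ be a connected DH graph, let $(T,\mathcal F)=ST(G)$ be its split tree, and let $x\ne y$ be two vertices of $G$. Let $P(x,y)$ be the path of $T$ between the leaves $x$ and $y$. Reading the nodes $v$ of $P(x,y)$ in order from $x$ to $y$ yields a well-defined word $W(x,y)$ over the alphabet $\{K,S,S_x,S_y\}$: the letter of $v$ is $K$ if $G_v$ is a clique; if $G_v$ is a star, the letter is $S$ if the tree-edge mapped by $\rho_v$ to the centre of $G_v$ is not on $P(x,y)$, $S_x$ if that edge is on the part of $P(x,y)$ between $x$ and $v$, and $S_y$ if it is on the part between $v$ and $y$. In the words below, each letter in brackets may be present or absent, independently. 1. If $xy\notin E(G)$, then $G+xy$ is DH if and only if $W(x,y)$ is one of the words $$(S_x)SS(S_y),\quad (S_x)SK(S_y),\quad (S_x)KS(S_y),\quad (S_x)S(S_y).$$ 2. If $xy\in E(G)$, then $G-xy$ is DH if and only if $W(x,y)$ is one of the words $$(S_x)S_yS_x(S_y),\quad (S_x)S_yK(S_y),\quad (S_x)KS_x(S_y),\quad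 (S_x)K(S_y),\quad (S_x)(S_y).$$ Moreover, if $W(x,y)$ is one of the words $(S_x)(S_y)$ (the empty word included), then $G-xy$ is not connected. -/

import Mathlib

namespace SplitTreeDH

/-- A graph is distance hereditary if in every connected induced subgraph the distance between any
two vertices is the same as in the whole graph. -/
def IsDistanceHereditary {V : Type*} (G : SimpleGraph V) : Prop :=
  ∀ S : Set V, (G.induce S).Connected → ∀ a b : S, (G.induce S).dist a b = G.dist (a : V) (b : V)

/-- The neighbourhood `N(S)` of a set of vertices. -/
def setNeighbors {V : Type*} (G : SimpleGraph V) (S : Set V) : Set V :=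
  {v | v ∉ S ∧ ∃ w ∈ S, G.Adj v w}

/-- `(A, Aᶜ)` is a split: both parts have at least two vertices, and every vertex of `N(A)` is
adjacent to every vertex of `N(Aᶜ)`. -/
def IsSplit {V : Type*} (G : SimpleGraph V) (A : Set V) : Prop :=
  A.Nontrivial ∧ Aᶜ.Nontrivial ∧ ∀ u ∈ setNeighbors G A, ∀ v ∈ setNeighbors G Aᶜ, G.Adj u v

/-- A graph is prime (for the split decomposition) if it has no split. -/
def IsSplitPrime {V : Type*} (G : SimpleGraph V) : Prop :=
  ∀ A : Set V, ¬ IsSplit G A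

/-- A graph is degenerate (for the split decomposition) if every bipartition of its vertex set into
two parts of size at least two is a split. -/
def IsSplitDegenerate {V : Type*} (G : SimpleGraph V) : Prop :=
  ∀ A : Set V, A.Nontrivial → Aᶜ.Nontrivial → IsSplit G A

/-- The clique. -/
def IsCliqueGraph {V : Type*} (G : SimpleGraph V) : Prop := G = ⊤

/-- The star with centre `c`. -/
def IsStarAt {V : Type*} (G : SimpleGraph V) (c : V) : Prop := G = SimpleGraph.starGraph c

/-- A graph-labelled tree. The marker vertex of `G_v` that corresponds to the tree-edge `vw` is
named by `w`, so that `G_v` is a graph on the neighbours of `v` in the tree. (At a leaf the label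
is a graph on at most one vertex and carries no information.) -/
structure GraphLabelledTree (N : Type*) where
  tree : SimpleGraph N
  isTree : tree.IsTree
  label : ∀ v : N, SimpleGraph (tree.neighborSet v)

namespace GraphLabelledTree

variable {N : Type*} (T : GraphLabelledTree N)

/-- A leaf has at most one incident tree-edge. -/
def IsLeaf (v : N) : Prop := (T.tree.neighborSet v).Subsingleton

/-- Vertices of the tree other than the leaves are the nodes. -/
def IsNode (v : N) : Prop := ¬ T.IsLeaf v

/-- The type of leaves. -/
abbrev Leaf : Type _ := {v : N // T.IsLeaf v}

/-- `u` is `l`-accessible: `u ≠ l`, and any two distinct tree-edges `vw`, `vw'` of the `l,u`-path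
with a common end `v` are mapped to adjacent marker vertices of `G_v`. -/
def Accessible (l u : N) : Prop :=
  l ≠ u ∧ ∃ p : T.tree.Walk l u, p.IsPath ∧
    ∀ (v w w' : N) (hw : T.tree.Adj v w) (hw' : T.tree.Adj v w'), w ≠ w' →
      s(v, w) ∈ p.edges → s(v, w') ∈ p.edges → (T.label v).Adj ⟨w, hw⟩ ⟨w', hw'⟩

theorem Accessible.symm {T : GraphLabelledTree N} {l u : N} (h : T.Accessible l u) :
    T.Accessible u l := by
  obtain ⟨hne, p, hp, hadj⟩ := h
  refine ⟨hne.symm, p.reverse, hp.reverse, ?_⟩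
  intro v w w' hw hw' hww h1 h2
  rw [SimpleGraph.Walk.edges_reverse, List.mem_reverse] at h1 h2
  exact hadj v w w' hw hw' hww h1 h2

/-- The accessibility graph `G(T, F)`, on the leaves of the tree. -/
def accessibilityGraph : SimpleGraph T.Leaf where
  Adj x y := T.Accessible x.1 y.1
  symm := ⟨fun _ _ h => h.symm⟩
  loopless := ⟨fun _ h => h.1 rfl⟩

/-- A clique-join applies to the tree-edge `uv`: both ends are nodes labelled by cliques. -/
def CliqueJoinable (u v : N) : Prop :=
  T.tree.Adj u v ∧ T.IsNode u ∧ T.IsNode v ∧ IsCliqueGraph (T.label u) ∧ IsCliqueGraph (T.label v)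

/-- A star-join applies to the tree-edge `uv`: both ends are nodes labelled by stars, and `uv` is
mapped to the centre of the star at `u` and to an extremity of the star at `v`. -/
def StarJoinable (u v : N) : Prop :=
  ∃ h : T.tree.Adj u v, T.IsNode u ∧ T.IsNode v ∧ IsStarAt (T.label u) ⟨v, h⟩ ∧
    ∃ c : T.tree.neighborSet v, IsStarAt (T.label v) c ∧ (c : N) ≠ u

/-- A graph-labelled tree is reduced if every node has degree at least three and neither a
clique-join nor a star-join can be applied. -/
def IsReduced : Prop :=
  (∀ v, T.IsNode v → 3 ≤ (T.tree.neighborSet v).encard) ∧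
    (∀ u v, ¬ T.CliqueJoinable u v) ∧ (∀ u v, ¬ T.StarJoinable u v)

end GraphLabelledTree

/-- A split tree of `G`: a reduced graph-labelled tree all of whose labels are prime or degenerate,
with `G` as its accessibility graph (`leafIso` names the leaf of each vertex of `G`). -/
structure SplitTree {V : Type*} (G : SimpleGraph V) (N : Type*) extends GraphLabelledTree N where
  isReduced : toGraphLabelledTree.IsReduced
  prime_or_degenerate : ∀ v, toGraphLabelledTree.IsNode v →
    IsSplitPrime (label v) ∨ IsSplitDegenerate (label v)
  leafIso : G ≃g toGraphLabelledTree.accessibilityGraph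

/-- The alphabet `{K, S, S_x, S_y}`. -/
inductive Letter
  | K
  | S
  | Sx
  | Sy

namespace GraphLabelledTree

variable {N : Type*} (T : GraphLabelledTree N)

/-- The letter of a node `v` whose predecessor and successor on the path from `x` to `y` are `a` and
`b`: `K` for a clique, `S`, `S_x`, `S_y` for a star with its centre mapped to a tree-edge off the
path, on the side of `x`, on the side of `y`. -/
def HasLetter (a v b : N) : Letter → Prop
  | Letter.K => IsCliqueGraph (T.label v)
  | Letter.S => ∃ c : T.tree.neighborSet v, IsStarAt (T.label v) c ∧ (c : N) ≠ a ∧ (c : N) ≠ b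
  | Letter.Sx => ∃ c : T.tree.neighborSet v, IsStarAt (T.label v) c ∧ (c : N) = a
  | Letter.Sy => ∃ c : T.tree.neighborSet v, IsStarAt (T.label v) c ∧ (c : N) = b

/-- `W` is the word read along the path from `x` to `y`: its letters are, in order, those of the
inner vertices of the path. -/
def IsPathWord (x y : N) (W : List Letter) : Prop :=
  ∃ p : T.tree.Walk x y, p.IsPath ∧ p.length = W.length + 1 ∧
    ∀ (i : ℕ) (hi : i < W.length),
      T.HasLetter (p.getVert i) (p.getVert (i + 1)) (p.getVert (i + 2)) W[i]

end GraphLabelledTree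

/-- `W` is the word `W(x, y)` of two vertices of `G`. -/
def SplitTree.IsWord {V : Type*} {G : SimpleGraph V} {N : Type*} (ST : SplitTree G N) (x y : V)
    (W : List Letter) : Prop :=
  ST.toGraphLabelledTree.IsPathWord (ST.leafIso x).1 (ST.leafIso y).1 W

/-- `W` is one of the words described by `(S_x) w (S_y)`; the letters in brackets are optional. -/
def Bracketed (w W : List Letter) : Prop :=
  ∃ a b : List Letter, (a = [] ∨ a = [Letter.Sx]) ∧ (b = [] ∨ b = [Letter.Sy]) ∧ W = a ++ w ++ b

end SplitTreeDH

/-!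
Distance heredity has a local test: a graph is distance hereditary if and only if it contains no
*obstruction*, an induced path of length at least three together with a common neighbour of its two
ends (`isDistanceHereditary_iff`). Obstructions are well behaved with respect to splits: one side of
any split contains at most one vertex of an obstruction (`IsObstruction.subsingleton_or`).

A connected distance hereditary graph with at least four vertices has a split, since a component of
the non-neighbours of a vertex is one side of a split, and if all these components are trivial, then
the graph is complete multipartite (`IsDistanceHereditary.not_isSplitPrime`). The labels of the
split tree are connected induced subgraphs of `G`, so they are all cliques or stars
(`SplitTree.isCliqueGraph_or_isStarAt`), and the word of `x` and `y` exists and is unique.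

The branches hanging off the path of the tree between `x` and `y` sort the vertices of `G` by
position (`PathStructure`). For vertices at different positions, adjacency depends only on whether
the first is open to the right and the second to the left, and on whether there is an `S` strictly
between them. The vertices at one position form one side of a split, also after `xy` is changed. An
obstruction created by the change contains both `x` and `y`, so it has at most one vertex at each
position. It avoids a bracketed letter, where it would have a vertex of degree one. For the words of
the theorem this leaves at most four vertices, fewer than the five of an obstruction
(`PathStructure.obstructionFree_of_bracketed`).

Conversely, one vertex at each position can be chosen so that the adjacencies are exactly those
dictated by the word, and leaving out the vertex at a letter other than `S` amounts to deleting that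
letter (`IsTransversal.of_sublist`). Three letters `S` hence give a hole in `G + xy`, and a few short
subwords give a house, a domino or a gem. As the tree is reduced, certain pairs of consecutive
letters do not occur, and every word without forbidden subwords is in the list of the theorem
(`add_cases`, `delete_cases`).
-/

/-! ### Obstructions to distance heredity -/

namespace SplitTreeDH

section Obstruction

variable {V : Type*}

/-- The vertices `p 0, …, p k` form, in this order, an induced path. Values of `p` beyond `k` are
irrelevant. -/
def IsInducedPath (G : SimpleGraph V) (p : ℕ → V) (k : ℕ) : Prop :=
  ∀ i j, i < j → j ≤ k → p i ≠ p j ∧ (G.Adj (p i) (p j) ↔ j = i + 1)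

/-- An obstruction to distance heredity: an induced path `p 0, …, p k` of length at least three and
a vertex `q` adjacent to both of its ends. Every hole, house, domino and gem contains one. -/
structure IsObstruction (G : SimpleGraph V) (p : ℕ → V) (k : ℕ) (q : V) : Prop where
  len : 3 ≤ k
  path : IsInducedPath G p k
  adj_left : G.Adj q (p 0)
  adj_right : G.Adj q (p k)

/-- A graph without obstructions. -/
def ObstructionFree (G : SimpleGraph V) : Prop :=
  ∀ p k q, ¬ IsObstruction G p k q

/-- The vertex set of an obstruction. -/
def obstructionSet (p : ℕ → V) (k : ℕ) (q : V) : Set V := {u | u = q ∨ ∃ i ≤ k, u = p i}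

theorem IsInducedPath.adj_succ {G : SimpleGraph V} {p : ℕ → V} {k : ℕ} (h : IsInducedPath G p k)
    {i : ℕ} (hi : i < k) : G.Adj (p i) (p (i + 1)) :=
  (h i (i + 1) (Nat.lt_succ_self i) hi).2.2 rfl

theorem IsInducedPath.mono {G : SimpleGraph V} {p : ℕ → V} {k l : ℕ} (h : IsInducedPath G p k)
    (hl : l ≤ k) : IsInducedPath G p l := fun i j hij hj => h i j hij (hj.trans hl)

theorem IsInducedPath.shift {G : SimpleGraph V} {p : ℕ → V} {k : ℕ} (h : IsInducedPath G p k)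
    (s : ℕ) : IsInducedPath G (fun i => p (i + s)) (k - s) := by
  intro i j hij hj
  obtain ⟨h1, h2⟩ := h (i + s) (j + s) (by omega) (by omega)
  exact ⟨h1, h2.trans (by omega)⟩

theorem IsInducedPath.map {W : Type*} {G : SimpleGraph V} {H : SimpleGraph W} (f : H ↪g G)
    {p : ℕ → W} {k : ℕ} (h : IsInducedPath H p k) : IsInducedPath G (fun i => f (p i)) k := by
  intro i j hij hj
  obtain ⟨h1, h2⟩ := h i j hij hj
  exact ⟨fun he => h1 (f.injective he), f.map_adj_iff.trans h2⟩

theorem ObstructionFree.of_embedding {W : Type*} {G : SimpleGraph V} {H : SimpleGraph W}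
    (f : H ↪g G) (h : ObstructionFree G) : ObstructionFree H := fun p k q ho =>
  h (fun i => f (p i)) k (f q)
    ⟨ho.len, ho.path.map f, f.map_adj_iff.2 ho.adj_left, f.map_adj_iff.2 ho.adj_right⟩

/-- A sequence of successively adjacent vertices is a walk. -/
theorem exists_walk_of_adj_succ {G : SimpleGraph V} {p : ℕ → V} {k : ℕ}
    (h : ∀ i < k, G.Adj (p i) (p (i + 1))) {i j : ℕ} (hij : i ≤ j) (hj : j ≤ k) :
    ∃ w : G.Walk (p i) (p j), w.length = j - i := by
  induction j, hij using Nat.le_induction with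
  | base => exact ⟨.nil, by simp⟩
  | succ j hij ih =>
    obtain ⟨w, hw⟩ := ih (by omega)
    exact ⟨w.concat (h j hj), by rw [SimpleGraph.Walk.length_concat, hw]; omega⟩

/-- Two vertices at distance two or less are equal, adjacent or have a common neighbour. -/
theorem eq_or_adj_or_of_dist_le_two {G : SimpleGraph V} {a b : V} (hr : G.Reachable a b)
    (hd : G.dist a b ≤ 2) : a = b ∨ G.Adj a b ∨ ∃ c, G.Adj a c ∧ G.Adj c b := by
  obtain ⟨w, hw⟩ := hr.exists_walk_length_eq_dist
  match w, hw with
  | .nil, _ => exact Or.inl rfl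
  | .cons h .nil, _ => exact Or.inr (Or.inl h)
  | .cons h (.cons h' .nil), _ => exact Or.inr (Or.inr ⟨_, h, h'⟩)
  | .cons _ (.cons _ (.cons _ w)), hw =>
    simp only [SimpleGraph.Walk.length_cons] at hw
    omega

theorem dist_le_two {G : SimpleGraph V} {a b c : V} (h : G.Adj a c) (h' : G.Adj c b) :
    G.dist a b ≤ 2 :=
  SimpleGraph.dist_le (.cons h (.cons h' .nil))

/-- A shortest path is induced. -/
theorem exists_isInducedPath_dist {G : SimpleGraph V} {a b : V} (hr : G.Reachable a b) :
    ∃ p : ℕ → V, IsInducedPath G p (G.dist a b) ∧ p 0 = a ∧ p (G.dist a b) = b := by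
  obtain ⟨w, hw⟩ := hr.exists_walk_length_eq_dist
  have hadj : ∀ i < w.length, G.Adj (w.getVert i) (w.getVert (i + 1)) :=
    fun i hi => w.adj_getVert_succ hi
  rw [← hw]
  refine ⟨w.getVert, ?_, w.getVert_zero, w.getVert_length⟩
  intro i j hij hj
  obtain ⟨w1, h1⟩ := exists_walk_of_adj_succ hadj (Nat.zero_le i) (by omega)
  obtain ⟨w2, h2⟩ := exists_walk_of_adj_succ hadj hj le_rfl
  have e0 : w.getVert 0 = a := w.getVert_zero
  have e1 : w.getVert w.length = b := w.getVert_length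
  have key : ∀ u : G.Walk (w.getVert i) (w.getVert j),
      w.length ≤ i + u.length + (w.length - j) := by
    intro u
    have := SimpleGraph.dist_le (((w1.copy e0 rfl).append u).append (w2.copy rfl e1))
    simp only [SimpleGraph.Walk.length_append, SimpleGraph.Walk.length_copy, h1, h2] at this
    omega
  refine ⟨fun he => ?_, fun h => ?_, fun h => h ▸ hadj i (by omega)⟩
  · have := key (SimpleGraph.Walk.nil.copy rfl he)
    simp only [SimpleGraph.Walk.length_copy, SimpleGraph.Walk.length_nil] at this
    omega
  · have := key h.toWalk
    simp only [SimpleGraph.Walk.length_cons, SimpleGraph.Walk.length_nil] at this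
    omega

theorem IsDistanceHereditary.obstructionFree {G : SimpleGraph V} (h : IsDistanceHereditary G) :
    ObstructionFree G := by
  rintro p k q ⟨hk, hp, h0, h1⟩
  let S : Set V := p '' Set.Iic k
  have hmem : ∀ i, i ≤ k → p i ∈ S := fun i hi => ⟨i, hi, rfl⟩
  have hreach : ∀ i (hi : i ≤ k), (G.induce S).Reachable ⟨p 0, hmem 0 (Nat.zero_le k)⟩
      ⟨p i, hmem i hi⟩ := by
    intro i
    induction i with
    | zero => intro _; exact SimpleGraph.Reachable.refl _
    | succ i ih =>
      intro hi
      refine (ih (by omega)).trans (SimpleGraph.Adj.reachable ?_)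
      exact hp.adj_succ hi
  have hc : (G.induce S).Connected := by
    rw [SimpleGraph.connected_iff_exists_forall_reachable]
    refine ⟨⟨p 0, hmem 0 (Nat.zero_le k)⟩, ?_⟩
    rintro ⟨_, i, hi, rfl⟩
    exact hreach i hi
  have hd := h S hc ⟨p 0, hmem 0 (Nat.zero_le k)⟩ ⟨p k, hmem k le_rfl⟩
  rcases eq_or_adj_or_of_dist_le_two (hreach k le_rfl) (hd.le.trans (dist_le_two h0.symm h1)) with
    he | he | ⟨⟨_, i, hi, rfl⟩, h2, h3⟩
  · exact (hp 0 k (by omega) le_rfl).1 (congrArg Subtype.val he)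
  · have := (hp 0 k (by omega) le_rfl).2.1 he
    omega
  · have h2 : G.Adj (p 0) (p i) := h2
    have h3 : G.Adj (p i) (p k) := h3
    have hi : i ≤ k := hi
    have i0 : i ≠ 0 := by rintro rfl; exact G.loopless.irrefl _ h2
    have ik : i ≠ k := by rintro rfl; exact G.loopless.irrefl _ h3
    have e1 := (hp 0 i (by omega) hi).2.1 h2
    have e2 := (hp i k (by omega) le_rfl).2.1 h3
    omega

/-- Without obstructions, every induced path is a shortest path. -/
theorem ObstructionFree.dist_eq {G : SimpleGraph V} (h : ObstructionFree G) (d : ℕ) :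
    ∀ (p : ℕ → V) (k : ℕ), IsInducedPath G p k → G.dist (p 0) (p k) = d → k = d := by
  induction d using Nat.strong_induction_on with
  | _ d ih =>
  intro p k hp hd
  obtain ⟨w, hw⟩ : ∃ w : G.Walk (p 0) (p k), w.length = k := by
    simpa using exists_walk_of_adj_succ (p := p) (fun i hi => hp.adj_succ hi) (Nat.zero_le k) le_rfl
  have hle := SimpleGraph.dist_le w
  by_contra hne
  have hdk : d < k := by omega
  have hr : G.Reachable (p 0) (p k) := w.reachable
  have hnadj : ¬ G.Adj (p 0) (p k) := fun ha => by
    have := (hp 0 k (by omega) le_rfl).2.1 ha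
    have h1 := SimpleGraph.dist_eq_one_iff_adj.2 ha
    omega
  have hd2 : 2 ≤ d := by
    have := hr.one_lt_dist_of_ne_of_not_adj (hp 0 k (by omega) le_rfl).1 hnadj
    omega
  -- `q` is the last but one vertex of a shortest path.
  obtain ⟨q, hq, hqd⟩ : ∃ q, G.Adj q (p k) ∧ G.dist (p 0) q = d - 1 := by
    obtain ⟨g, hg, g0, g1⟩ := exists_isInducedPath_dist hr
    rw [hd] at hg g1
    refine ⟨g (d - 1), ?_, ?_⟩
    · rw [← g1]
      exact (hg (d - 1) d (by omega) le_rfl).2.2 (by omega)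
    · obtain ⟨w1, hw1⟩ : ∃ w : G.Walk (p 0) (g (d - 1)), w.length = d - 1 := by
        rw [← g0]
        simpa using exists_walk_of_adj_succ (p := g) (k := d) (fun i hi => hg.adj_succ hi)
          (Nat.zero_le (d - 1)) (by omega)
      have a1 := SimpleGraph.dist_le w1
      have a3 : G.Adj (g (d - 1)) (p k) := by
        rw [← g1]; exact (hg (d - 1) d (by omega) le_rfl).2.2 (by omega)
      have a4 := w1.reachable.exists_walk_length_eq_dist
      obtain ⟨w2, hw2⟩ := a4
      have := SimpleGraph.dist_le (w2.concat a3)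
      rw [SimpleGraph.Walk.length_concat] at this
      omega
  have hqp : ∀ i, i ≤ k → p i ≠ q := by
    rintro i hi rfl
    have hik : i ≠ k := by rintro rfl; exact G.loopless.irrefl _ hq
    have e := (hp i k (by omega) le_rfl).2.1 hq
    have := ih (d - 1) (by omega) p i (hp.mono hi) hqd
    omega
  obtain ⟨j, ⟨hjk, hjq⟩, hmin⟩ : ∃ j, (j ≤ k ∧ G.Adj (p j) q) ∧
      ∀ i < j, ¬ (i ≤ k ∧ G.Adj (p i) q) := by
    classical
    have hex : ∃ j, j ≤ k ∧ G.Adj (p j) q := ⟨k, le_rfl, hq.symm⟩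
    exact ⟨Nat.find hex, Nat.find_spec hex, fun i hi => Nat.find_min hex hi⟩
  have hp' : IsInducedPath G (fun i => if i ≤ j then p i else q) (j + 1) := by
    intro i l hil hl
    rcases Nat.lt_or_ge j l with hjl | hjl
    · obtain rfl : l = j + 1 := by omega
      simp only [if_pos (show i ≤ j by omega), if_neg (show ¬ j + 1 ≤ j by omega)]
      refine ⟨hqp i (by omega), fun ha => ?_, fun he => ?_⟩
      · by_contra hij
        exact hmin i (by omega) ⟨by omega, ha⟩
      · obtain rfl : j = i := by omega
        exact hjq
    · simp only [if_pos (show i ≤ j by omega), if_pos (show l ≤ j from hjl)]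
      exact hp i l hil (by omega)
  have hj := ih (d - 1) (by omega) _ _ hp' (by
    rw [if_pos (by omega), if_neg (by omega)]; exact hqd)
  refine h (fun i => p (i + j)) (k - j) q ⟨by omega, hp.shift j, ?_, ?_⟩
  · rw [Nat.zero_add]; exact hjq.symm
  · rw [Nat.sub_add_cancel hjk]; exact hq

theorem ObstructionFree.isDistanceHereditary {G : SimpleGraph V} (h : ObstructionFree G) :
    IsDistanceHereditary G := by
  intro S hS a b
  obtain ⟨p, hp, h0, h1⟩ := exists_isInducedPath_dist (hS a b)
  refine h.dist_eq _ _ _ (hp.map (SimpleGraph.Embedding.induce S)) ?_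
  change G.dist (p 0 : V) (p _ : V) = _
  rw [h0, h1]

theorem isDistanceHereditary_iff {G : SimpleGraph V} :
    IsDistanceHereditary G ↔ ObstructionFree G :=
  ⟨fun h => h.obstructionFree, fun h => h.isDistanceHereditary⟩

/-! ### Obstructions and splits -/

/-- The edges between `A` and its complement form a complete bipartite graph between their ends.
In contrast to a split, `A` may have fewer than two vertices. -/
def IsSplitLike (G : SimpleGraph V) (A : Set V) : Prop :=
  ∀ u ∈ A, ∀ u' ∈ A, ∀ v ∉ A, ∀ v' ∉ A, G.Adj u v → G.Adj u' v' → G.Adj u v'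

theorem IsSplitLike.compl {G : SimpleGraph V} {A : Set V} (h : IsSplitLike G A) :
    IsSplitLike G Aᶜ := by
  intro u hu u' hu' v hv v' hv' h1 h2
  rw [Set.notMem_compl_iff] at hv hv'
  exact (h v' hv' v hv u' hu' u hu h2.symm h1.symm).symm

theorem IsSplitLike.isSplit {G : SimpleGraph V} {A : Set V} (h : IsSplitLike G A)
    (h1 : A.Nontrivial) (h2 : Aᶜ.Nontrivial) : IsSplit G A := by
  refine ⟨h1, h2, ?_⟩
  rintro u ⟨hu, a, ha, hua⟩ v ⟨hv, b, hb, hvb⟩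
  rw [Set.notMem_compl_iff] at hv
  exact (h v hv a ha b hb u hu hvb hua.symm).symm

theorem IsSplit.isSplitLike {G : SimpleGraph V} {A : Set V} (h : IsSplit G A) :
    IsSplitLike G A := fun u hu u' hu' v hv v' hv' h1 h2 =>
  (h.2.2 v' ⟨hv', u', hu', h2.symm⟩ u ⟨fun hc => hc hu, v, hv, h1⟩).symm

/-- If a property holds at `a` and fails at `b ≥ a`, there is a first place where it is lost. -/
theorem exists_first_loss {P : ℕ → Prop} {a b : ℕ} (hab : a ≤ b) (ha : P a) (hb : ¬ P b) :
    ∃ m, a ≤ m ∧ m < b ∧ (∀ i, a ≤ i → i ≤ m → P i) ∧ ¬ P (m + 1) := by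
  classical
  have hex : ∃ n, a ≤ n ∧ ¬ P n := ⟨b, hab, hb⟩
  have hs := Nat.find_spec hex
  have hm : ∀ i < Nat.find hex, a ≤ i → P i := fun i hi hai => by
    by_contra hc; exact Nat.find_min hex hi ⟨hai, hc⟩
  have hle : Nat.find hex ≤ b := Nat.find_min' hex ⟨hab, hb⟩
  have hne : Nat.find hex ≠ a := fun he => hs.2 (he.symm ▸ ha)
  refine ⟨Nat.find hex - 1, by omega, by omega, fun i h1 h2 => hm i (by omega) h1, ?_⟩
  rw [show Nat.find hex - 1 + 1 = Nat.find hex by omega]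
  exact hs.2

theorem IsInducedPath.reverse {G : SimpleGraph V} {p : ℕ → V} {k : ℕ} (h : IsInducedPath G p k) :
    IsInducedPath G (fun i => p (k - i)) k := by
  intro i j hij hj
  obtain ⟨h1, h2⟩ := h (k - j) (k - i) (by omega) (by omega)
  exact ⟨h1.symm, (G.adj_comm _ _).trans (h2.trans (by omega))⟩

theorem IsObstruction.reverse {G : SimpleGraph V} {p : ℕ → V} {k : ℕ} {q : V}
    (h : IsObstruction G p k q) : IsObstruction G (fun i => p (k - i)) k q :=
  ⟨h.len, h.path.reverse, by simpa using h.adj_right, by simpa using h.adj_left⟩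

/-- The case `q ∈ A`, `p 0 ∈ A` of `IsObstruction.subsingleton_or`: at most one vertex of the path
lies outside `A`. Indeed, if the path first leaves `A` from `p m` to `p (m + 1)`, then `p m` is
adjacent to every vertex outside `A` that has a neighbour in `A`. -/
theorem IsObstruction.eq_of_notMem_of_zero_mem {G : SimpleGraph V} {p : ℕ → V} {k : ℕ} {q : V}
    (ho : IsObstruction G p k q) {A : Set V} (hA : IsSplitLike G A) (hq : q ∈ A) (h0 : p 0 ∈ A)
    {i j : ℕ} (hi : i ≤ k) (hj : j ≤ k) (hiA : p i ∉ A) (hjA : p j ∉ A) : i = j := by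
  obtain ⟨m, -, hmi, hm, hm1⟩ := exists_first_loss (P := fun n => p n ∈ A) (Nat.zero_le i) h0 hiA
  have hk := ho.len
  have hpm := hm m (Nat.zero_le m) le_rfl
  have e1 : G.Adj (p m) (p (m + 1)) := ho.path.adj_succ (by omega)
  suffices h : ∀ l, l ≤ k → p l ∉ A → l = m + 1 from (h i hi hiA).trans (h j hj hjA).symm
  intro l hl hlA
  by_contra hne
  have hml : m < l := by
    by_contra hc; exact hlA (hm l (Nat.zero_le l) (by omega))
  -- if the path returns to `A` after `p l`, the last vertex before the return is adjacent to `p m`;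
  -- otherwise `p k` is, as it is adjacent to `q ∈ A`
  by_cases hpk : p k ∈ A
  · obtain ⟨r, hr1, hr2, hr3, hr4⟩ := exists_first_loss (P := fun n => p n ∉ A)
      (show l ≤ k from hl) hlA (not_not.2 hpk)
    rw [not_not] at hr4
    have hrA := hr3 r hr1 le_rfl
    have e2 := hA _ hpm _ hr4 _ hm1 _ hrA e1 (ho.path.adj_succ hr2).symm
    have := (ho.path m r (by omega) (by omega)).2.1 e2
    omega
  · have e2 := hA _ hpm _ hq _ hm1 _ hpk e1 ho.adj_right
    have e3 := (ho.path m k (by omega) le_rfl).2.1 e2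
    omega

theorem IsObstruction.subsingleton_or_of_mem {G : SimpleGraph V} {p : ℕ → V} {k : ℕ} {q : V}
    (ho : IsObstruction G p k q) {A : Set V} (hA : IsSplitLike G A) (hq : q ∈ A) :
    (obstructionSet p k q ∩ A).Subsingleton ∨ (obstructionSet p k q \ A).Subsingleton := by
  have hk := ho.len
  by_cases h0 : p 0 ∈ A
  · right
    rintro u ⟨hu, huA⟩ v ⟨hv, hvA⟩
    obtain rfl | ⟨i, hi, rfl⟩ := hu
    · exact absurd hq huA
    obtain rfl | ⟨j, hj, rfl⟩ := hv
    · exact absurd hq hvA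
    rw [ho.eq_of_notMem_of_zero_mem hA hq h0 hi hj huA hvA]
  by_cases h1 : p k ∈ A
  · right
    rintro u ⟨hu, huA⟩ v ⟨hv, hvA⟩
    obtain rfl | ⟨i, hi, rfl⟩ := hu
    · exact absurd hq huA
    obtain rfl | ⟨j, hj, rfl⟩ := hv
    · exact absurd hq hvA
    have := ho.reverse.eq_of_notMem_of_zero_mem hA hq (by simpa using h1)
      (i := k - i) (j := k - j) (by omega) (by omega)
      (by rwa [Nat.sub_sub_self hi]) (by rwa [Nat.sub_sub_self hj])
    rw [show i = j by omega]
  · left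
    suffices h : ∀ i ≤ k, p i ∉ A by
      rintro u ⟨hu, huA⟩ v ⟨hv, hvA⟩
      obtain rfl | ⟨i, hi, rfl⟩ := hu
      · obtain rfl | ⟨j, hj, rfl⟩ := hv
        · rfl
        · exact absurd hvA (h j hj)
      · exact absurd huA (h i hi)
    intro i hi hiA
    -- the first vertex of the path in `A` would be adjacent to both of its ends, as `q` is
    obtain ⟨m, -, hmi, hm, hm1⟩ := exists_first_loss (P := fun n => p n ∉ A) (Nat.zero_le i) h0
      (not_not.2 hiA)
    rw [not_not] at hm1
    have e := (ho.path.adj_succ (show m < k by omega)).symm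
    have hpm := hm m (Nat.zero_le m) le_rfl
    have e1 := hA _ hm1 _ hq _ hpm _ h0 e ho.adj_left
    have e2 := hA _ hm1 _ hq _ hpm _ h1 e ho.adj_right
    have hmk : m + 1 ≠ k := fun hc => h1 (hc ▸ hm1)
    have f1 := (ho.path 0 (m + 1) (by omega) (by omega)).2.1 e1.symm
    have f2 := (ho.path (m + 1) k (by omega) le_rfl).2.1 e2
    omega

/-- An obstruction cannot be split: one of the two sides contains at most one of its vertices. -/
theorem IsObstruction.subsingleton_or {G : SimpleGraph V} {p : ℕ → V} {k : ℕ} {q : V}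
    (ho : IsObstruction G p k q) {A : Set V} (hA : IsSplitLike G A) :
    (obstructionSet p k q ∩ A).Subsingleton ∨ (obstructionSet p k q \ A).Subsingleton := by
  by_cases hq : q ∈ A
  · exact ho.subsingleton_or_of_mem hA hq
  · have := ho.subsingleton_or_of_mem hA.compl hq
    rw [Set.sdiff_compl, ← Set.sdiff_eq] at this
    exact this.symm

/-- Every vertex of an obstruction has two distinct neighbours in it. -/
theorem IsObstruction.exists_two_neighbors {G : SimpleGraph V} {p : ℕ → V} {k : ℕ} {q : V}
    (ho : IsObstruction G p k q) {u : V} (hu : u ∈ obstructionSet p k q) :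
    ∃ v ∈ obstructionSet p k q, ∃ w ∈ obstructionSet p k q, v ≠ w ∧ G.Adj u v ∧ G.Adj u w := by
  have hk := ho.len
  have hq : ∀ i, 0 < i → i < k → q ≠ p i := by
    rintro i h0 h1 rfl
    have f1 := (ho.path 0 i h0 h1.le).2.1 ho.adj_left.symm
    have f2 := (ho.path i k h1 le_rfl).2.1 ho.adj_right
    omega
  obtain rfl | ⟨i, hi, rfl⟩ := hu
  · exact ⟨p 0, Or.inr ⟨0, by omega, rfl⟩, p k, Or.inr ⟨k, le_rfl, rfl⟩,
      (ho.path 0 k (by omega) le_rfl).1, ho.adj_left, ho.adj_right⟩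
  · rcases Nat.eq_zero_or_pos i with rfl | h0
    · exact ⟨q, Or.inl rfl, p 1, Or.inr ⟨1, by omega, rfl⟩, hq 1 (by omega) (by omega),
        ho.adj_left.symm, ho.path.adj_succ (by omega)⟩
    · have e := ho.path.adj_succ (show i - 1 < k by omega)
      rw [Nat.sub_add_cancel h0] at e
      rcases Nat.lt_or_ge i k with hik | hik
      · exact ⟨p (i - 1), Or.inr ⟨i - 1, by omega, rfl⟩, p (i + 1), Or.inr ⟨i + 1, hik, rfl⟩,
          (ho.path (i - 1) (i + 1) (by omega) hik).1, e.symm, ho.path.adj_succ hik⟩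
      · obtain rfl : i = k := by omega
        exact ⟨q, Or.inl rfl, p (i - 1), Or.inr ⟨i - 1, by omega, rfl⟩,
          hq _ (by omega) (by omega), ho.adj_right.symm, e.symm⟩

/-- An obstruction has at least five vertices: no map into four values is injective on it. -/
theorem IsObstruction.not_injOn {G : SimpleGraph V} {p : ℕ → V} {k : ℕ} {q : V}
    (ho : IsObstruction G p k q) {f : V → ℕ} {s : Finset ℕ} (hs : s.card ≤ 4)
    (hf : ∀ u ∈ obstructionSet p k q, f u ∈ s) : ¬ Set.InjOn f (obstructionSet p k q) := by
  intro hinj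
  have hk := ho.len
  have hp : ∀ i, i ≤ k → p i ∈ obstructionSet p k q := fun i hi => Or.inr ⟨i, hi, rfl⟩
  have hq : ∀ i, i ≤ k → q ≠ p i := by
    rintro i hi rfl
    have i0 : i ≠ 0 := by rintro rfl; exact G.loopless.irrefl _ ho.adj_left
    have ik : i ≠ k := by rintro rfl; exact G.loopless.irrefl _ ho.adj_right
    have f1 := (ho.path 0 i (by omega) hi).2.1 ho.adj_left.symm
    have f2 := (ho.path i k (by omega) le_rfl).2.1 ho.adj_right
    omega
  let g : ℕ → V := fun i => if i = 4 then q else p i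
  have hg : ∀ i ∈ Finset.range 5, g i ∈ obstructionSet p k q := by
    intro i hi
    rw [Finset.mem_range] at hi
    by_cases h4 : i = 4
    · simp only [g, if_pos h4]; exact Or.inl rfl
    · simp only [g, if_neg h4]; exact hp i (by omega)
  have hginj : Set.InjOn g (Finset.range 5) := by
    intro i hi j hj hij
    rw [Finset.mem_coe, Finset.mem_range] at hi hj
    by_contra hne
    by_cases h4 : i = 4
    · simp only [g, if_pos h4, if_neg (show j ≠ 4 by omega)] at hij
      exact hq j (by omega) hij
    · by_cases h4' : j = 4
      · simp only [g, if_pos h4', if_neg h4] at hij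
        exact hq i (by omega) hij.symm
      · simp only [g, if_neg h4', if_neg h4] at hij
        rcases Nat.lt_or_gt_of_ne hne with h | h
        · exact (ho.path i j h (by omega)).1 hij
        · exact (ho.path j i h (by omega)).1 hij.symm
  have := Finset.card_le_card_of_injOn (s := Finset.range 5) (t := s) (fun i => f (g i))
    (fun i hi => hf _ (hg i hi)) (fun i hi j hj hij => hginj hi hj (hinj (hg i hi) (hg j hj) hij))
  rw [Finset.card_range] at this
  omega

end Obstruction

/-! ### Prime and degenerate graphs -/

section PrimeDegenerate

variable {V : Type*} {G : SimpleGraph V}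

/-- In a distance hereditary graph without splits, non-adjacency to `r` is inherited: the
non-neighbours of a vertex are pairwise non-adjacent. Otherwise a component of the subgraph of
non-neighbours of `r` would be one side of a split. -/
theorem IsDistanceHereditary.not_adj_of_isSplitPrime (hc : G.Connected)
    (hDH : IsDistanceHereditary G) (hp : IsSplitPrime G) {r u v : V} (hru : r ≠ u) (hrv : r ≠ v)
    (hu : ¬ G.Adj r u) (hv : ¬ G.Adj r v) : ¬ G.Adj u v := by
  intro huv
  let C : Set V :=
    {w | Relation.ReflTransGen (fun a b => G.Adj a b ∧ r ≠ b ∧ ¬ G.Adj r b) u w}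
  have huC : u ∈ C := Relation.ReflTransGen.refl
  have hvC : v ∈ C := Relation.ReflTransGen.single ⟨huv, hrv, hv⟩
  have hC : ∀ w ∈ C, r ≠ w ∧ ¬ G.Adj r w := by
    intro w hw
    rcases Relation.ReflTransGen.cases_tail hw with rfl | ⟨b, -, hb⟩
    · exact ⟨hru, hu⟩
    · exact hb.2
  have hout : ∀ s ∈ C, ∀ a ∉ C, G.Adj s a → G.Adj r a := by
    intro s hs a ha hsa
    by_contra hra
    refine ha (hs.tail ⟨hsa, ?_, hra⟩)
    rintro rfl
    exact (hC s hs).2 hsa.symm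
  have hsplit : IsSplitLike G C := by
    intro s hs s' hs' a ha a' ha' hsa hsa'
    have hra := hout s hs a ha hsa
    have hra' := hout s' hs' a' ha' hsa'
    -- `C` together with `r` and `a'` is connected, and `a'` is the only neighbour of `r` in it
    let S : Set V := insert r (insert a' C)
    have hrS : r ∈ S := Or.inl rfl
    have haS : a' ∈ S := Or.inr (Or.inl rfl)
    have hCS : ∀ w ∈ C, w ∈ S := fun w hw => Or.inr (Or.inr hw)
    have hreach : ∀ w (hw : w ∈ C), (G.induce S).Reachable ⟨u, hCS u huC⟩ ⟨w, hCS w hw⟩ := by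
      intro w hw
      induction hw with
      | refl => exact SimpleGraph.Reachable.refl _
      | tail hb hbc ih => exact ih.trans (SimpleGraph.Adj.reachable hbc.1)
    have hreach' : ∀ w (hw : w ∈ S), (G.induce S).Reachable ⟨u, hCS u huC⟩ ⟨w, hw⟩ := by
      have h1 : (G.induce S).Reachable ⟨u, hCS u huC⟩ ⟨a', haS⟩ :=
        (hreach s' hs').trans (SimpleGraph.Adj.reachable hsa')
      rintro w (rfl | rfl | hw)
      · exact h1.trans (SimpleGraph.Adj.reachable hra'.symm)
      · exact h1
      · exact hreach w hw
    have hS : (G.induce S).Connected := by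
      rw [SimpleGraph.connected_iff_exists_forall_reachable]
      exact ⟨⟨u, hCS u huC⟩, fun w => hreach' w.1 w.2⟩
    have hd := hDH S hS ⟨r, hrS⟩ ⟨s, hCS s hs⟩
    rcases eq_or_adj_or_of_dist_le_two (hS _ _) (hd.le.trans (dist_le_two hra hsa.symm)) with
      he | he | ⟨⟨c, hcS⟩, h1, h2⟩
    · exact absurd (congrArg Subtype.val he) (hC s hs).1
    · exact absurd he (hC s hs).2
    · have h1 : G.Adj r c := h1
      have h2 : G.Adj c s := h2
      rcases hcS with rfl | rfl | hcC
      · exact absurd h1 (G.loopless.irrefl _)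
      · exact h2.symm
      · exact absurd h1 (hC c hcC).2
  refine hp C (hsplit.isSplit ⟨u, huC, v, hvC, huv.ne⟩ ?_)
  obtain ⟨a, hra⟩ : ∃ a, G.Adj r a := by
    obtain ⟨w⟩ := hc r u
    cases w with
    | nil => exact absurd rfl hru
    | cons h _ => exact ⟨_, h⟩
  exact ⟨r, fun h => (hC r h).1 rfl, a, fun h => (hC a h).2 hra, hra.ne⟩

/-- A connected distance hereditary graph with at least four vertices has a split. -/
theorem IsDistanceHereditary.not_isSplitPrime (hc : G.Connected)
    (hDH : IsDistanceHereditary G) (h4 : ∀ u v : V, ({u, v}ᶜ : Set V).Nontrivial) :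
    ¬ IsSplitPrime G := by
  intro hp
  have key := fun {r u v : V} => hDH.not_adj_of_isSplitPrime hc hp (r := r) (u := u) (v := v)
  by_cases hcl : ∀ u v, u ≠ v → G.Adj u v
  · -- in a clique every bipartition is a split
    obtain ⟨r⟩ := hc.nonempty
    obtain ⟨u, -, v, -, huv⟩ := h4 r r
    refine hp {u, v} (IsSplitLike.isSplit ?_ (Set.nontrivial_pair huv) (h4 u v))
    intro s hs s' _ a _ a' ha' _ _
    exact hcl s a' (fun he => ha' (he ▸ hs))
  · -- non-adjacent vertices are false twins
    push Not at hcl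
    obtain ⟨u, v, huv, hnadj⟩ := hcl
    refine hp {u, v} (IsSplitLike.isSplit ?_ (Set.nontrivial_pair huv) (h4 u v))
    intro s hs s' hs' a _ a' ha' hsa hsa'
    by_cases hss : s = s'
    · exact hss ▸ hsa'
    by_contra hn
    refine key hss (fun he : s = a' => ha' (he ▸ hs)) ?_ hn hsa'
    rcases hs with rfl | rfl <;> rcases hs' with rfl | rfl
    · exact absurd rfl hss
    · exact hnadj
    · exact fun h => hnadj h.symm
    · exact absurd rfl hss

/-- A connected graph in which the ends of any two disjoint edges span a clique is a clique or a
star. -/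
theorem isCliqueGraph_or_isStarAt (hc : G.Connected)
    (h : ∀ a b c d, G.Adj a b → G.Adj c d → a ≠ c → a ≠ d → b ≠ c → b ≠ d → G.Adj a c) :
    IsCliqueGraph G ∨ ∃ c, IsStarAt G c := by
  by_cases hcl : ∀ u v, u ≠ v → G.Adj u v
  · left
    ext u v
    exact ⟨fun h => h.ne, fun h => hcl u v h⟩
  right
  push Not at hcl
  obtain ⟨u, v, c, huv, hnadj, huc, hcv⟩ :
      ∃ u v c, u ≠ v ∧ ¬ G.Adj u v ∧ G.Adj u c ∧ G.Adj c v := by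
    obtain ⟨a, b, hab, hnab⟩ := hcl
    obtain ⟨p, hp, h0, h1⟩ := exists_isInducedPath_dist (hc a b)
    have := hc.one_lt_dist_of_ne_of_not_adj hab hnab
    refine ⟨p 0, p 2, p 1, (hp 0 2 (by omega) (by omega)).1, ?_, hp.adj_succ (by omega),
      hp.adj_succ (by omega)⟩
    rw [(hp 0 2 (by omega) (by omega)).2]
    omega
  -- an edge that avoids `c` would be disjoint from `uc` or from `cv`
  have hcover : ∀ a b, G.Adj a b → a = c ∨ b = c := by
    intro a b hab
    have hab' := hab.ne
    by_contra hcon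
    push Not at hcon
    obtain ⟨hac, hbc⟩ := hcon
    have key : ∀ u v, u ≠ v → ¬ G.Adj u v → G.Adj u c → G.Adj c v → u ≠ a → u ≠ b → False := by
      intro u v huv hn huc hcv hua hub
      by_cases hva : v = a
      · subst hva
        exact hn (h _ _ _ _ huc hab hua hub hac.symm hbc.symm)
      by_cases hvb : v = b
      · subst hvb
        exact hn (h _ _ _ _ huc hab.symm hub hua hbc.symm hac.symm)
      have h1 := h _ _ _ _ huc hab hua hub hac.symm hbc.symm
      have h2 := h _ _ _ _ hcv.symm hab.symm hvb hva hbc.symm hac.symm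
      exact hn (h _ _ _ _ h1 h2 huv hub (fun he => hva he.symm) hab')
    by_cases hu : u = a ∨ u = b
    · refine key v u huv.symm (fun h => hnadj h.symm) hcv.symm huc.symm ?_ ?_
      · rintro rfl
        rcases hu with rfl | rfl
        · exact huv rfl
        · exact hnadj hab.symm
      · rintro rfl
        rcases hu with rfl | rfl
        · exact hnadj hab
        · exact huv rfl
    · push Not at hu
      exact key u v huv hnadj huc hcv hu.1 hu.2
  refine ⟨c, ?_⟩
  unfold IsStarAt
  have hcen : ∀ a, a ≠ c → G.Adj a c := by
    intro a hac
    obtain ⟨w⟩ := hc a c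
    cases w with
    | nil => exact absurd rfl hac
    | cons hadj _ =>
      rcases hcover _ _ hadj with h1 | h1
      · exact absurd h1 hac
      · exact h1 ▸ hadj
  ext a b
  rw [SimpleGraph.starGraph_adj]
  constructor
  · exact fun hab => ⟨hab.ne, hcover a b hab⟩
  · rintro ⟨hne, rfl | rfl⟩
    · exact (hcen b hne.symm).symm
    · exact hcen a hne

/-- A connected distance hereditary graph that is prime or degenerate is a clique or a star. -/
theorem IsDistanceHereditary.isCliqueGraph_or_isStarAt (hc : G.Connected)
    (hDH : IsDistanceHereditary G) (h : IsSplitPrime G ∨ IsSplitDegenerate G) :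
    IsCliqueGraph G ∨ ∃ c, IsStarAt G c := by
  refine SplitTreeDH.isCliqueGraph_or_isStarAt hc ?_
  intro a b c d hab hcd hac had hbc hbd
  have hab' := hab.ne
  have hcd' := hcd.ne
  rcases h with h | h
  · refine absurd h (hDH.not_isSplitPrime hc fun u v => ?_)
    rw [← Set.not_subsingleton_iff]
    intro hs
    have hs' : ∀ x y, x ≠ y → (x = u ∨ x = v) ∨ (y = u ∨ y = v) := by
      intro x y hxy
      by_contra hcon
      push Not at hcon
      refine hxy (hs ?_ ?_)
      · simp only [Set.mem_compl_iff, Set.mem_insert_iff, Set.mem_singleton_iff]; tauto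
      · simp only [Set.mem_compl_iff, Set.mem_insert_iff, Set.mem_singleton_iff]; tauto
    have h1 := hs' a b hab'
    have h2 := hs' a c hac
    have h3 := hs' a d had
    have h4 := hs' b c hbc
    have h5 := hs' b d hbd
    have h6 := hs' c d hcd'
    grind
  · -- the two edges cross the split `{a, d} | rest`
    have hsp := (h {a, d} (Set.nontrivial_pair had)
      ⟨b, by simp [hab'.symm, hbd], c, by simp [hac.symm, hcd'], hbc⟩).isSplitLike
    exact hsp a (by simp) d (by simp) b (by simp [hab'.symm, hbd]) c (by simp [hac.symm, hcd'])
      hab hcd.symm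

end PrimeDegenerate

/-! ### Branches of a graph-labelled tree -/

namespace GraphLabelledTree

variable {N : Type*} (T : GraphLabelledTree N)

/-- The marker vertices of the tree-edges `va` and `vc` are adjacent in the label of `v`. -/
def MarkerAdj (v a c : N) : Prop :=
  ∃ (ha : T.tree.Adj v a) (hc : T.tree.Adj v c), (T.label v).Adj ⟨a, ha⟩ ⟨c, hc⟩

/-- Any two consecutive edges of the walk have adjacent marker vertices. As labels have no loops,
such a walk never turns back. -/
def IsAlternating {u v : N} (p : T.tree.Walk u v) : Prop :=
  p.darts.IsChain fun d d' => T.MarkerAdj d.snd d.fst d'.snd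

/-- `u` lies in the branch of the directed tree-edge `ab`, that is, on the side of `b`. -/
def InBranch (a b u : N) : Prop :=
  ∃ (h : T.tree.Adj a b) (p : T.tree.Walk b u), (SimpleGraph.Walk.cons h p).IsPath

/-- `u` lies in the branch of the directed tree-edge `ab`, and the path from `a` to `u` is
alternating. -/
def AccessibleThrough (a b u : N) : Prop :=
  ∃ (h : T.tree.Adj a b) (p : T.tree.Walk b u), T.IsAlternating (SimpleGraph.Walk.cons h p)

variable {T}

theorem MarkerAdj.symm {v a c : N} (h : T.MarkerAdj v a c) : T.MarkerAdj v c a := by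
  obtain ⟨ha, hc, h⟩ := h
  exact ⟨hc, ha, h.symm⟩

theorem markerAdj_comm {v a c : N} : T.MarkerAdj v a c ↔ T.MarkerAdj v c a :=
  ⟨fun h => h.symm, fun h => h.symm⟩

theorem MarkerAdj.ne {v a c : N} (h : T.MarkerAdj v a c) : a ≠ c := by
  obtain ⟨ha, hc, h⟩ := h
  exact fun he => h.ne (Subtype.ext he)

theorem isAlternating_cons_cons {a b c u : N} (h : T.tree.Adj a b) (h' : T.tree.Adj b c)
    (p : T.tree.Walk c u) :
    T.IsAlternating (.cons h (.cons h' p)) ↔ T.MarkerAdj b a c ∧ T.IsAlternating (.cons h' p) := by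
  simp [IsAlternating]

/-- The condition of `IsAlternating` for the reversed darts. -/
theorem isAlternating_iff_symm {u v : N} (p : T.tree.Walk u v) :
    T.IsAlternating p ↔ p.darts.IsChain fun d d' => T.MarkerAdj d'.fst d'.snd d.fst := by
  match p with
  | .nil => exact iff_of_true List.isChain_nil List.isChain_nil
  | .cons h .nil => exact iff_of_true (List.isChain_singleton _) (List.isChain_singleton _)
  | .cons h (.cons h' p) =>
    rw [isAlternating_cons_cons, isAlternating_iff_symm, markerAdj_comm]
    simp

theorem path_unique {a b : N} {p q : T.tree.Walk a b} (hp : p.IsPath) (hq : q.IsPath) : p = q :=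
  (T.isTree.existsUnique_path a b).unique hp hq

theorem isPath_cons_cons {a b c u : N} (h : T.tree.Adj a b) (h' : T.tree.Adj b c)
    (p : T.tree.Walk c u) :
    (SimpleGraph.Walk.cons h (.cons h' p)).IsPath ↔
      a ≠ c ∧ (SimpleGraph.Walk.cons h' p).IsPath := by
  rw [T.isTree.isAcyclic.isPath_iff_isChain, T.isTree.isAcyclic.isPath_iff_isChain]
  simp only [SimpleGraph.Walk.edges_cons, List.isChain_cons_cons]
  refine and_congr_left fun _ => not_congr ?_
  rw [Sym2.eq_iff]
  constructor
  · rintro (⟨rfl, -⟩ | ⟨h1, -⟩)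
    · exact absurd rfl h.ne
    · exact h1
  · exact fun h1 => Or.inr ⟨h1, rfl⟩

theorem IsAlternating.isPath {a u : N} {p : T.tree.Walk a u} (hp : T.IsAlternating p) :
    p.IsPath := by
  match p, hp with
  | .nil, _ => exact SimpleGraph.Walk.IsPath.nil
  | .cons h .nil, _ => simpa using h.ne
  | .cons h (.cons h' p), hp =>
    rw [isAlternating_cons_cons] at hp
    exact (isPath_cons_cons h h' p).2 ⟨hp.1.ne, hp.2.isPath⟩

theorem isAlternating_of_forall {a u : N} {p : T.tree.Walk a u} (hp : p.IsPath)
    (h : ∀ (v w w' : N) (hw : T.tree.Adj v w) (hw' : T.tree.Adj v w'), w ≠ w' →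
      s(v, w) ∈ p.edges → s(v, w') ∈ p.edges → (T.label v).Adj ⟨w, hw⟩ ⟨w', hw'⟩) :
    T.IsAlternating p := by
  match p, hp, h with
  | .nil, _, _ => exact List.isChain_nil
  | .cons h .nil, _, _ => exact List.isChain_singleton _
  | .cons h (.cons h' p), hp, hall =>
    rw [isPath_cons_cons] at hp
    rw [isAlternating_cons_cons]
    refine ⟨⟨h.symm, h', hall _ _ _ h.symm h' hp.1 ?_ ?_⟩, isAlternating_of_forall hp.2 ?_⟩
    · simp [Sym2.eq_swap]
    · simp
    · intro v w w' hw hw' hne h1 h2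
      exact hall v w w' hw hw' hne (List.mem_cons_of_mem _ h1) (List.mem_cons_of_mem _ h2)

theorem IsAlternating.forall {a u : N} {p : T.tree.Walk a u} (hp : T.IsAlternating p) :
    ∀ (v w w' : N) (hw : T.tree.Adj v w) (hw' : T.tree.Adj v w'), w ≠ w' →
      s(v, w) ∈ p.edges → s(v, w') ∈ p.edges → (T.label v).Adj ⟨w, hw⟩ ⟨w', hw'⟩ := by
  induction p with
  | nil => intro v w w' _ _ _ h1; simp at h1
  | @cons a b u h p ih =>
    have hpath := hp.isPath
    have hp' : T.IsAlternating p := List.IsChain.tail hp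
    rw [SimpleGraph.Walk.cons_isPath_iff] at hpath
    -- the case that the first of the two edges is the first edge of the walk
    have key : ∀ (v w w' : N) (hw : T.tree.Adj v w) (hw' : T.tree.Adj v w'), w ≠ w' →
        s(v, w) = s(a, b) → s(v, w') ∈ p.edges → (T.label v).Adj ⟨w, hw⟩ ⟨w', hw'⟩ := by
      intro v w w' hw hw' hne h1 h2
      rcases Sym2.eq_iff.1 h1 with ⟨rfl, rfl⟩ | ⟨rfl, rfl⟩
      · exact absurd (p.fst_mem_support_of_mem_edges h2) hpath.2
      · cases p with
        | nil => simp at h2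
        | @cons _ c _ h' q =>
          rw [isAlternating_cons_cons] at hp
          rw [SimpleGraph.Walk.edges_cons, List.mem_cons] at h2
          rcases h2 with h2 | h2
          · rcases Sym2.eq_iff.1 h2 with ⟨-, rfl⟩ | ⟨rfl, -⟩
            · exact hp.1.2.2
            · exact absurd rfl h'.ne
          · exact absurd (q.fst_mem_support_of_mem_edges h2)
              (SimpleGraph.Walk.cons_isPath_iff _ _ |>.1 hpath.1).2
    intro v w w' hw hw' hne h1 h2
    rw [SimpleGraph.Walk.edges_cons, List.mem_cons] at h1 h2
    rcases h1 with h1 | h1 <;> rcases h2 with h2 | h2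
    · rw [← h2, Sym2.congr_right] at h1
      exact absurd h1 hne
    · exact key v w w' hw hw' hne h1 h2
    · exact (key v w' w hw' hw hne.symm h2 h1).symm
    · exact ih hp' v w w' hw hw' hne h1 h2

/-- Accessibility is read off from the path, which is unique. -/
theorem accessible_iff {l u : N} {p : T.tree.Walk l u} (hp : p.IsPath) (hne : l ≠ u) :
    T.Accessible l u ↔ T.IsAlternating p := by
  constructor
  · rintro ⟨-, q, hq, h⟩
    rw [path_unique hp hq]
    exact isAlternating_of_forall hq h
  · exact fun h => ⟨hne, p, hp, h.forall⟩

theorem InBranch.adj {a b u : N} (h : T.InBranch a b u) : T.tree.Adj a b := h.1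

theorem AccessibleThrough.inBranch {a b u : N} (h : T.AccessibleThrough a b u) :
    T.InBranch a b u :=
  let ⟨hab, p, hp⟩ := h
  ⟨hab, p, hp.isPath⟩

theorem inBranch_self {a b : N} (h : T.tree.Adj a b) : T.InBranch a b b :=
  ⟨h, .nil, by simpa using h.ne⟩

theorem InBranch.step {a b c u : N} (h : T.InBranch b c u) (hab : T.tree.Adj a b) (hac : a ≠ c) :
    T.InBranch a b u := by
  obtain ⟨hbc, p, hp⟩ := h
  exact ⟨hab, .cons hbc p, (isPath_cons_cons hab hbc p).2 ⟨hac, hp⟩⟩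

theorem InBranch.eq_or_exists {a b u : N} (h : T.InBranch a b u) :
    u = b ∨ ∃ c, a ≠ c ∧ T.InBranch b c u := by
  obtain ⟨hab, p, hp⟩ := h
  cases p with
  | nil => exact Or.inl rfl
  | cons hbc q =>
    rw [isPath_cons_cons] at hp
    exact Or.inr ⟨_, hp.1, hbc, q, hp.2⟩

theorem InBranch.eq_of_isLeaf {a b u : N} (h : T.InBranch a b u) (hb : T.IsLeaf b) : u = b := by
  rcases h.eq_or_exists with he | ⟨c, hac, hc⟩
  · exact he
  · exact absurd (hb h.adj.symm hc.adj) hac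

theorem exists_inBranch {v u : N} (h : u ≠ v) : ∃ w, T.InBranch v w u := by
  obtain ⟨p, hp, -⟩ := T.isTree.existsUnique_path v u
  cases p with
  | nil => exact absurd rfl h
  | cons hvw q => exact ⟨_, hvw, q, hp⟩

theorem InBranch.unique {v w w' u : N} (h : T.InBranch v w u) (h' : T.InBranch v w' u) :
    w = w' := by
  obtain ⟨h1, p, hp⟩ := h
  obtain ⟨h2, q, hq⟩ := h'
  have := path_unique hp hq
  simp only [SimpleGraph.Walk.cons.injEq] at this
  exact this.1

theorem InBranch.ne {a b u : N} (h : T.InBranch a b u) : u ≠ a := by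
  rintro rfl
  obtain ⟨h1, p, hp⟩ := h
  exact (SimpleGraph.Walk.cons_isPath_iff _ _ |>.1 hp).2 p.end_mem_support

theorem inBranch_or {a b : N} (h : T.tree.Adj a b) (u : N) :
    T.InBranch a b u ∨ T.InBranch b a u := by
  by_cases hu : u = a
  · exact Or.inr (hu.symm ▸ inBranch_self h.symm)
  · obtain ⟨w, hw⟩ := exists_inBranch (T := T) hu
    by_cases hwb : b = w
    · exact Or.inl (hwb ▸ hw)
    · exact Or.inr (hw.step h.symm hwb)

theorem InBranch.not_symm {a b u : N} (h : T.InBranch a b u) : ¬ T.InBranch b a u := by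
  rintro ⟨hba, p, hp⟩
  obtain ⟨hab, q, hq⟩ := h
  rw [SimpleGraph.Walk.cons_isPath_iff] at hp
  apply hp.2
  rw [path_unique hp.1 hq]
  simp

/-- Accessibility through `ab` propagates along the tree. -/
theorem accessibleThrough_step {a b c u : N} (hab : T.tree.Adj a b) (h : T.InBranch b c u) :
    T.AccessibleThrough a b u ↔ T.MarkerAdj b a c ∧ T.AccessibleThrough b c u := by
  constructor
  · rintro ⟨hab, p, hp⟩
    obtain ⟨hbc, q, hq⟩ := h
    obtain rfl := path_unique (SimpleGraph.Walk.cons_isPath_iff _ _ |>.1 hp.isPath).1 hq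
    rw [isAlternating_cons_cons] at hp
    exact ⟨hp.1, hbc, q, hp.2⟩
  · rintro ⟨h1, hbc, q, hq⟩
    exact ⟨hab, .cons hbc q, (isAlternating_cons_cons hab hbc q).2 ⟨h1, hq⟩⟩

theorem accessibleThrough_self {a b : N} (h : T.tree.Adj a b) : T.AccessibleThrough a b b :=
  ⟨h, .nil, List.isChain_singleton _⟩

/-- Every tree-edge `ab` splits the accessibility graph: vertices in different branches of `ab` are
accessible from each other if and only if both are accessible through `ab`. -/
theorem accessible_iff_of_inBranch {a b u v : N} (hu : T.InBranch b a u) (hv : T.InBranch a b v) :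
    T.Accessible u v ↔ T.AccessibleThrough b a u ∧ T.AccessibleThrough a b v := by
  have hne : u ≠ v := by rintro rfl; exact hv.not_symm hu
  obtain ⟨hba, p, hp⟩ := hu
  obtain ⟨hab, q, hq⟩ := hv
  have hpath : (p.reverse.append (.cons hab q)).IsPath := by
    rw [T.isTree.isAcyclic.isPath_iff_isChain] at hp hq ⊢
    rw [SimpleGraph.Walk.edges_append, SimpleGraph.Walk.edges_cons, List.isChain_split,
      SimpleGraph.Walk.edges_reverse]
    refine ⟨?_, by simpa using hq⟩
    rw [← List.isChain_reverse]
    rw [SimpleGraph.Walk.edges_cons, Sym2.eq_swap] at hp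
    simpa [ne_comm] using hp
  have halt : T.IsAlternating (p.reverse.append (.cons hab q)) ↔
      T.IsAlternating (.cons hba p) ∧ T.IsAlternating (.cons hab q) := by
    unfold IsAlternating
    rw [SimpleGraph.Walk.darts_append, SimpleGraph.Walk.darts_cons, List.isChain_split]
    refine and_congr_left fun _ => ?_
    have e : p.reverse.darts ++ [⟨(a, b), hab⟩] =
        ((SimpleGraph.Walk.cons hba p).darts.map SimpleGraph.Dart.symm).reverse := by
      rw [SimpleGraph.Walk.darts_reverse, SimpleGraph.Walk.darts_cons, List.map_cons,
        List.reverse_cons]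
      rfl
    rw [e, List.isChain_reverse, List.isChain_map]
    exact (isAlternating_iff_symm _).symm
  rw [accessible_iff hpath hne, halt]
  constructor
  · rintro ⟨h1, h2⟩
    exact ⟨⟨hba, p, h1⟩, hab, q, h2⟩
  · rintro ⟨⟨_, p', h1⟩, _, q', h2⟩
    rw [path_unique hp h1.isPath, path_unique hq h2.isPath]
    exact ⟨h1, h2⟩

/-- Vertices in different branches at `b` are accessible from each other if and only if both are
accessible from `b` and their branches have adjacent marker vertices. -/
theorem accessible_iff_of_inBranch_of_ne {b c c' u u' : N} (hcc : c ≠ c') (hu : T.InBranch b c u)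
    (hu' : T.InBranch b c' u') :
    T.Accessible u u' ↔
      T.AccessibleThrough b c u ∧ T.MarkerAdj b c c' ∧ T.AccessibleThrough b c' u' := by
  rw [accessible_iff_of_inBranch hu (hu'.step hu.adj.symm hcc),
    accessibleThrough_step hu.adj.symm hu']

/-- Every branch of a finite tree contains a leaf. -/
theorem exists_isLeaf_inBranch [Finite N] {a b : N} (h : T.tree.Adj a b) :
    ∃ u, T.IsLeaf u ∧ T.InBranch a b u := by
  induction hn : {u | T.InBranch a b u}.ncard using Nat.strong_induction_on generalizing a b with
  | _ n ih =>
  by_cases hb : T.IsLeaf b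
  · exact ⟨b, hb, inBranch_self h⟩
  obtain ⟨c, hc, hca⟩ : ∃ c, T.tree.Adj b c ∧ a ≠ c := by
    obtain ⟨c, hc, d, hd, hcd⟩ := Set.not_subsingleton_iff.1 hb
    by_cases hac : a = c
    · exact ⟨d, hd, hac ▸ hcd⟩
    · exact ⟨c, hc, hac⟩
  have hsub : {u | T.InBranch b c u} ⊂ {u | T.InBranch a b u} := by
    refine ⟨fun u hu => InBranch.step hu h hca, fun hs => ?_⟩
    exact InBranch.ne (hs (inBranch_self h : b ∈ {u | T.InBranch a b u})) rfl
  obtain ⟨u, hu, hu'⟩ := ih _ (hn ▸ Set.ncard_lt_ncard hsub (Set.toFinite _)) hc rfl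
  exact ⟨u, hu, hu'.step h hca⟩

/-- If the accessibility graph is connected, every branch contains a leaf that is accessible from
outside. -/
theorem exists_accessibleThrough [Finite N] (hc : T.accessibilityGraph.Connected) {a b : N}
    (h : T.tree.Adj a b) : ∃ u, T.IsLeaf u ∧ T.AccessibleThrough a b u := by
  obtain ⟨u, hu, hu'⟩ := exists_isLeaf_inBranch h.symm
  obtain ⟨v, hv, hv'⟩ := exists_isLeaf_inBranch h
  obtain ⟨w⟩ := hc ⟨u, hu⟩ ⟨v, hv⟩
  obtain ⟨d, -, h1, h2⟩ := w.exists_boundary_dart {x | T.InBranch b a x.1} hu' hv'.not_symm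
  have h3 := (inBranch_or h d.snd.1).resolve_right h2
  exact ⟨d.snd.1, d.snd.2, ((accessible_iff_of_inBranch h1 h3).1 d.adj).2⟩

theorem IsNode.ne_of_isLeaf {v u : N} (hv : T.IsNode v) (hu : T.IsLeaf u) : u ≠ v := by
  rintro rfl; exact hv hu

/-- The labels of a graph-labelled tree with connected accessibility graph are connected. -/
theorem connected_label [Finite N] (hc : T.accessibilityGraph.Connected) {v : N}
    (hv : T.IsNode v) : (T.label v).Connected := by
  have key : ∀ {l l' : T.Leaf} (p : T.accessibilityGraph.Walk l l') (w w' : N)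
      (hw : T.InBranch v w l.1) (hw' : T.InBranch v w' l'.1),
      (T.label v).Reachable ⟨w, hw.adj⟩ ⟨w', hw'.adj⟩ := by
    intro l l' p
    induction p with
    | nil =>
      intro w w' hw hw'
      obtain rfl := hw.unique hw'
      exact SimpleGraph.Reachable.refl _
    | @cons l m l' hadj p ih =>
      intro w w' hw hw'
      obtain ⟨z, hz⟩ := exists_inBranch (hv.ne_of_isLeaf m.2)
      refine SimpleGraph.Reachable.trans ?_ (ih z w' hz hw')
      by_cases hwz : w = z
      · subst hwz; exact SimpleGraph.Reachable.refl _
      · obtain ⟨-, ⟨_, _, h⟩, -⟩ := (accessible_iff_of_inBranch_of_ne hwz hw hz).1 hadj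
        exact h.reachable
  obtain ⟨a, ha, -, -, -⟩ := Set.not_subsingleton_iff.1 hv
  have : Nonempty (T.tree.neighborSet v) := ⟨⟨a, ha⟩⟩
  refine ⟨fun w w' => ?_⟩
  obtain ⟨l, hl, hl'⟩ := exists_isLeaf_inBranch w.2
  obtain ⟨m, hm, hm'⟩ := exists_isLeaf_inBranch w'.2
  obtain ⟨p⟩ := hc ⟨l, hl⟩ ⟨m, hm⟩
  exact key p w w' hl' hm'

/-- Each label is an induced subgraph of a connected accessibility graph: choose an accessible leaf
in every branch. -/
theorem nonempty_label_embedding [Finite N] (hc : T.accessibilityGraph.Connected) (v : N) :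
    Nonempty (T.label v ↪g T.accessibilityGraph) := by
  choose f hf hf' using fun w : T.tree.neighborSet v => exists_accessibleThrough hc w.2
  have hinj : Function.Injective f := fun w w' h => by
    have h1 := (hf' w).inBranch
    rw [h] at h1
    exact Subtype.ext (h1.unique (hf' w').inBranch)
  refine ⟨⟨⟨fun w => ⟨f w, hf w⟩, fun w w' h => hinj (congrArg Subtype.val h)⟩, ?_⟩⟩
  intro w w'
  change T.Accessible (f w) (f w') ↔ _
  by_cases hww : w = w'
  · subst hww
    exact ⟨fun h => absurd rfl h.1, fun h => absurd rfl h.ne⟩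
  · rw [accessible_iff_of_inBranch_of_ne (fun h => hww (Subtype.ext h)) (hf' w).inBranch
      (hf' w').inBranch]
    exact ⟨fun h => h.2.1.2.2, fun h => ⟨hf' w, ⟨w.2, w'.2, h⟩, hf' w'⟩⟩

end GraphLabelledTree

variable {V : Type*} {G : SimpleGraph V} {N : Type*}

theorem SplitTree.connected_accessibilityGraph (ST : SplitTree G N) (hc : G.Connected) :
    ST.accessibilityGraph.Connected :=
  ST.leafIso.connected_iff.1 hc

/-- Every node of the split tree of a connected distance hereditary graph is labelled by a clique or
a star. -/
theorem SplitTree.isCliqueGraph_or_isStarAt [Finite N] (ST : SplitTree G N) (hc : G.Connected)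
    (hDH : IsDistanceHereditary G) {v : N} (hv : ST.IsNode v) :
    IsCliqueGraph (ST.label v) ∨ ∃ c, IsStarAt (ST.label v) c := by
  have hc' := ST.connected_accessibilityGraph hc
  obtain ⟨f⟩ := GraphLabelledTree.nonempty_label_embedding hc' v
  refine IsDistanceHereditary.isCliqueGraph_or_isStarAt
    (GraphLabelledTree.connected_label hc' hv) ?_ (ST.prime_or_degenerate v hv)
  rw [isDistanceHereditary_iff] at hDH ⊢
  exact hDH.of_embedding (f.trans ST.leafIso.symm.toEmbedding)

/-! ### The word of a path in the split tree -/

namespace GraphLabelledTree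

variable {N : Type*} {T : GraphLabelledTree N}

theorem markerAdj_iff_of_isCliqueGraph {v a c : N} (h : IsCliqueGraph (T.label v))
    (ha : T.tree.Adj v a) (hc : T.tree.Adj v c) : T.MarkerAdj v a c ↔ a ≠ c := by
  refine ⟨fun h => h.ne, fun hne => ⟨ha, hc, ?_⟩⟩
  rw [show T.label v = ⊤ from h, SimpleGraph.top_adj]
  exact fun he => hne (congrArg Subtype.val he)

theorem markerAdj_iff_of_isStarAt {v a c : N} {z : T.tree.neighborSet v}
    (h : IsStarAt (T.label v) z) (ha : T.tree.Adj v a) (hc : T.tree.Adj v c) :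
    T.MarkerAdj v a c ↔ a ≠ c ∧ (a = z ∨ c = z) := by
  have e : (T.label v).Adj ⟨a, ha⟩ ⟨c, hc⟩ ↔ a ≠ c ∧ (a = z ∨ c = z) := by
    rw [show T.label v = SimpleGraph.starGraph z from h, SimpleGraph.starGraph_adj]
    simp only [ne_eq, Subtype.ext_iff]
  rw [← e]
  exact ⟨fun ⟨_, _, h⟩ => h, fun h => ⟨ha, hc, h⟩⟩

theorem isNode_of_adj {v a b : N} (ha : T.tree.Adj v a) (hb : T.tree.Adj v b) (hab : a ≠ b) :
    T.IsNode v := fun h => hab (h ha hb)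

theorem IsReduced.exists_third (hT : T.IsReduced) {v : N} (hv : T.IsNode v) (a b : N) :
    ∃ w, T.tree.Adj v w ∧ w ≠ a ∧ w ≠ b := by
  by_contra hcon
  push Not at hcon
  have h1 := hT.1 v hv
  have h2 : T.tree.neighborSet v ⊆ {a, b} := by
    intro w hw
    by_cases hwa : w = a
    · exact Or.inl hwa
    · exact Or.inr (hcon w hw hwa)
  have h3 := (h1.trans (Set.encard_le_encard h2)).trans (Set.encard_insert_le _ _)
  rw [Set.encard_singleton] at h3
  exact absurd h3 (by decide)

/-- The letter of a node determines how its marker vertices are joined. -/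
theorem HasLetter.markerAdj_iff {a v b : N} {l : Letter} (h : T.HasLetter a v b l)
    (ha : T.tree.Adj v a) (hb : T.tree.Adj v b) (hab : a ≠ b) :
    T.MarkerAdj v a b ↔ l ≠ Letter.S := by
  cases l with
  | K => simpa using (markerAdj_iff_of_isCliqueGraph h ha hb).2 hab
  | S =>
    obtain ⟨c, hc, hca, hcb⟩ := h
    rw [markerAdj_iff_of_isStarAt hc ha hb]
    simp [hca.symm, hcb.symm]
  | Sx =>
    obtain ⟨c, hc, rfl⟩ := h
    rw [markerAdj_iff_of_isStarAt hc ha hb]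
    simp [hab]
  | Sy =>
    obtain ⟨c, hc, rfl⟩ := h
    rw [markerAdj_iff_of_isStarAt hc ha hb]
    simp [hab]

theorem HasLetter.not_markerAdj_of_sx {a v b w : N} (h : T.HasLetter a v b Letter.Sx)
    (hab : a ≠ b) (hwa : w ≠ a) : ¬ T.MarkerAdj v b w := by
  obtain ⟨c, hc, rfl⟩ := h
  intro hm
  have := (markerAdj_iff_of_isStarAt hc hm.1 hm.2.1).1 hm
  tauto

theorem HasLetter.not_markerAdj_of_sy {a v b w : N} (h : T.HasLetter a v b Letter.Sy)
    (hab : a ≠ b) (hwb : w ≠ b) : ¬ T.MarkerAdj v a w := by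
  obtain ⟨c, hc, rfl⟩ := h
  intro hm
  have := (markerAdj_iff_of_isStarAt hc hm.1 hm.2.1).1 hm
  tauto

theorem HasLetter.markerAdj_iff_markerAdj {a v b w : N} {l : Letter} (h : T.HasLetter a v b l)
    (hl : l = Letter.K ∨ l = Letter.S) (ha : T.tree.Adj v a) (hb : T.tree.Adj v b)
    (hw : T.tree.Adj v w) (hwa : w ≠ a) (hwb : w ≠ b) :
    T.MarkerAdj v a w ↔ T.MarkerAdj v b w := by
  rcases hl with rfl | rfl
  · rw [markerAdj_iff_of_isCliqueGraph h ha hw, markerAdj_iff_of_isCliqueGraph h hb hw]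
    exact iff_of_true hwa.symm hwb.symm
  · obtain ⟨c, hc, hca, hcb⟩ := h
    rw [markerAdj_iff_of_isStarAt hc ha hw, markerAdj_iff_of_isStarAt hc hb hw]
    simp [hca.symm, hcb.symm, hwa.symm, hwb.symm]

/-- Every node has a marker vertex off the path whose adjacencies are as full as its letter
allows. -/
theorem HasLetter.exists_marker (hT : T.IsReduced) {a v b : N} {l : Letter}
    (h : T.HasLetter a v b l) (ha : T.tree.Adj v a) (hb : T.tree.Adj v b) (hab : a ≠ b) :
    ∃ w, T.tree.Adj v w ∧ w ≠ a ∧ w ≠ b ∧ (T.MarkerAdj v a w ↔ l ≠ Letter.Sy) ∧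
      (T.MarkerAdj v b w ↔ l ≠ Letter.Sx) := by
  obtain ⟨w, hw, hwa, hwb⟩ := hT.exists_third (isNode_of_adj ha hb hab) a b
  cases l with
  | K =>
    refine ⟨w, hw, hwa, hwb, ?_, ?_⟩
    · simpa using (markerAdj_iff_of_isCliqueGraph h ha hw).2 hwa.symm
    · simpa using (markerAdj_iff_of_isCliqueGraph h hb hw).2 hwb.symm
  | S =>
    obtain ⟨c, hc, hca, hcb⟩ := h
    refine ⟨c, c.2, hca, hcb, ?_, ?_⟩
    · rw [markerAdj_iff_of_isStarAt hc ha c.2]; simp [hca.symm]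
    · rw [markerAdj_iff_of_isStarAt hc hb c.2]; simp [hcb.symm]
  | Sx =>
    refine ⟨w, hw, hwa, hwb, ?_, by simpa using h.not_markerAdj_of_sx hab hwa⟩
    obtain ⟨c, hc, rfl⟩ := h
    rw [markerAdj_iff_of_isStarAt hc ha hw]; simp [hwa.symm]
  | Sy =>
    refine ⟨w, hw, hwa, hwb, by simpa using h.not_markerAdj_of_sy hab hwb, ?_⟩
    obtain ⟨c, hc, rfl⟩ := h
    rw [markerAdj_iff_of_isStarAt hc hb hw]; simp [hwb.symm]

theorem IsReduced.not_isCliqueGraph_of_isStarAt (hT : T.IsReduced) {v : N} (hv : T.IsNode v)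
    {c : T.tree.neighborSet v} (hc : IsStarAt (T.label v) c) : ¬ IsCliqueGraph (T.label v) := by
  intro hcl
  obtain ⟨w, hw, hwc, -⟩ := hT.exists_third hv c c
  obtain ⟨z, hz, hzc, hzw⟩ := hT.exists_third hv c w
  have h1 := (markerAdj_iff_of_isCliqueGraph hcl hw hz).2 hzw.symm
  rw [markerAdj_iff_of_isStarAt hc hw hz] at h1
  tauto

theorem IsReduced.center_unique (hT : T.IsReduced) {v : N} (hv : T.IsNode v)
    {c d : T.tree.neighborSet v} (hc : IsStarAt (T.label v) c) (hd : IsStarAt (T.label v) d) :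
    (c : N) = d := by
  by_contra hcd
  obtain ⟨w, hw, hwc, hwd⟩ := hT.exists_third hv c d
  have h1 := (markerAdj_iff_of_isStarAt hc hw c.2).2 ⟨hwc, Or.inr rfl⟩
  rw [markerAdj_iff_of_isStarAt hd hw c.2] at h1
  tauto

theorem HasLetter.unique (hT : T.IsReduced) {a v b : N} {l l' : Letter} (h : T.HasLetter a v b l)
    (h' : T.HasLetter a v b l') (hv : T.IsNode v) (hab : a ≠ b) : l = l' := by
  have key := fun c hc => hT.not_isCliqueGraph_of_isStarAt hv (c := c) hc
  have cen := fun c d hc hd => hT.center_unique hv (c := c) (d := d) hc hd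
  cases l <;> cases l' <;> first
    | rfl
    | (exfalso
       simp only [HasLetter] at h h'
       grind)

theorem exists_hasLetter {a v b : N}
    (h : IsCliqueGraph (T.label v) ∨ ∃ c, IsStarAt (T.label v) c) : ∃ l, T.HasLetter a v b l := by
  rcases h with h | ⟨c, hc⟩
  · exact ⟨Letter.K, h⟩
  · by_cases hca : (c : N) = a
    · exact ⟨Letter.Sx, c, hc, hca⟩
    · by_cases hcb : (c : N) = b
      · exact ⟨Letter.Sy, c, hc, hcb⟩
      · exact ⟨Letter.S, c, hc, hca, hcb⟩

end GraphLabelledTree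

/-- Two letters that may follow each other along a path of a reduced graph-labelled tree. -/
def Compatible : Letter → Letter → Prop
  | .K, .K => False
  | .Sy, .Sy => False
  | .Sy, .S => False
  | .Sx, .Sx => False
  | .S, .Sx => False
  | _, _ => True

theorem GraphLabelledTree.IsReduced.compatible {N : Type*} {T : GraphLabelledTree N}
    (hT : T.IsReduced) {a u v b : N} {l l' : Letter} (hau : T.tree.Adj u a) (huv : T.tree.Adj u v)
    (hvb : T.tree.Adj v b) (hav : a ≠ v) (hub : u ≠ b) (h : T.HasLetter a u v l)
    (h' : T.HasLetter u v b l') : Compatible l l' := by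
  have hu := GraphLabelledTree.isNode_of_adj hau huv hav
  have hv := GraphLabelledTree.isNode_of_adj huv.symm hvb hub
  obtain ⟨-, hK, hS⟩ := hT
  have key1 : ∀ (c : T.tree.neighborSet u) (d : T.tree.neighborSet v),
      IsStarAt (T.label u) c → IsStarAt (T.label v) d → (c : N) = v → (d : N) = u := by
    rintro ⟨c, hc'⟩ d hc hd rfl
    by_contra hdu
    exact hS u c ⟨huv, hu, hv, hc, d, hd, hdu⟩
  have key2 : ∀ (c : T.tree.neighborSet u) (d : T.tree.neighborSet v),
      IsStarAt (T.label u) c → IsStarAt (T.label v) d → (d : N) = u → (c : N) = v := by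
    rintro c ⟨d, hd'⟩ hc hd rfl
    by_contra hcv
    exact hS v d ⟨huv.symm, hv, hu, hd, c, hc, hcv⟩
  cases l <;> cases l' <;> simp only [Compatible] <;>
    simp only [GraphLabelledTree.HasLetter] at h h'
  · exact hK u v ⟨huv, hu, hv, h, h'⟩
  all_goals
    obtain ⟨c, hc, hc'⟩ := h
    obtain ⟨d, hd, hd'⟩ := h'
    have k1 := key1 c d hc hd
    have k2 := key2 c d hc hd
    grind

/-- The position of the vertices of `G` relative to the path of the split tree between `x` and `y`,
whose nodes have the letters of `W`. A vertex has position `m + 1` if its leaf hangs off the node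
with letter `W[m]`; `x` and `y` have the extremal positions. A vertex is open to the left or to the
right if it is accessible from the path in that direction. -/
structure PathStructure {V : Type*} (G : SimpleGraph V) (x y : V) (W : List Letter) where
  pos : V → ℕ
  left : V → Prop
  right : V → Prop
  pos_le : ∀ u, pos u ≤ W.length + 1
  pos_eq_zero : ∀ u, pos u = 0 ↔ u = x
  pos_eq_last : ∀ u, pos u = W.length + 1 ↔ u = y
  right_first : right x
  left_last : left y
  adj_iff : ∀ u v, pos u < pos v → (G.Adj u v ↔ right u ∧ left v ∧
    ∀ m, pos u < m + 1 → m + 1 < pos v → W[m]? ≠ some Letter.S)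
  not_right : ∀ u m, pos u = m + 1 → W[m]? = some Letter.Sx → ¬ right u
  not_left : ∀ u m, pos u = m + 1 → W[m]? = some Letter.Sy → ¬ left u
  left_iff_right : ∀ u m, pos u = m + 1 → W[m]? = some Letter.K ∨ W[m]? = some Letter.S →
    (left u ↔ right u)
  exists_rep : ∀ m l, W[m]? = some l →
    ∃ u, pos u = m + 1 ∧ (left u ↔ l ≠ Letter.Sy) ∧ (right u ↔ l ≠ Letter.Sx)

variable {V : Type*} {G : SimpleGraph V} {N : Type*}

/-- The number of initial edges of the path `P 0, …, P (n + 1)` whose branches contain a given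
vertex. -/
theorem GraphLabelledTree.exists_position {T : GraphLabelledTree N} {P : ℕ → N} {n : ℕ}
    (hadj : ∀ i ≤ n, T.tree.Adj (P i) (P (i + 1))) (hne : ∀ i < n, P i ≠ P (i + 2)) (u : N) :
    ∃ k ≤ n + 1, ∀ i ≤ n, i < k ↔ T.InBranch (P i) (P (i + 1)) u := by
  classical
  have hex : ∃ k, k = n + 1 ∨ ¬ T.InBranch (P k) (P (k + 1)) u := ⟨n + 1, Or.inl rfl⟩
  have hanti : ∀ j, j ≤ n → T.InBranch (P j) (P (j + 1)) u → ∀ i ≤ j,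
      T.InBranch (P i) (P (i + 1)) u := by
    intro j hj h i hij
    induction hij using Nat.decreasingInduction with
    | self => exact h
    | of_succ k hk ih => exact ih.step (hadj k (by omega)) (hne k (by omega))
  refine ⟨Nat.find hex, Nat.find_min' hex (Or.inl rfl), fun i hi => ⟨fun h => ?_, fun h => ?_⟩⟩
  · by_contra hcon
    exact Nat.find_min hex h (Or.inr hcon)
  · by_contra hcon
    rcases Nat.find_spec hex with h1 | h1
    · omega
    · exact h1 (hanti i hi h _ (by omega))

/-- The path of the split tree between `x` and `y`, as a sequence of vertices. -/
theorem SplitTree.IsWord.exists_path {ST : SplitTree G N} {x y : V} {W : List Letter}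
    (h : ST.IsWord x y W) : ∃ P : ℕ → N, P 0 = (ST.leafIso x).1 ∧
      P (W.length + 1) = (ST.leafIso y).1 ∧ (∀ i ≤ W.length, ST.tree.Adj (P i) (P (i + 1))) ∧
      (∀ i < W.length, P i ≠ P (i + 2)) ∧ ∀ m l, W[m]? = some l →
        ST.HasLetter (P m) (P (m + 1)) (P (m + 2)) l := by
  obtain ⟨p, hp, hlen, hW⟩ := h
  refine ⟨p.getVert, p.getVert_zero, by rw [← hlen, p.getVert_length],
    fun i hi => p.adj_getVert_succ (by omega), fun i hi he => ?_, fun m l hl => ?_⟩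
  · have := hp.getVert_injOn (by simp; omega) (by simp; omega) he
    omega
  · obtain ⟨hm, rfl⟩ := List.getElem?_eq_some_iff.1 hl
    exact hW m hm

/-- The path between two leaves of the split tree determines the adjacencies between vertices at
different positions. -/
theorem SplitTree.IsWord.nonempty_pathStructure [Finite N] {ST : SplitTree G N}
    (hc : G.Connected) {x y : V} {W : List Letter} (h : ST.IsWord x y W) :
    Nonempty (PathStructure G x y W) := by
  obtain ⟨P, hx, hy, hadj, hne, hW⟩ := h.exists_path
  have hc' := ST.connected_accessibilityGraph hc
  choose pos hpos_le hpos using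
    fun u : V => GraphLabelledTree.exists_position hadj hne (ST.leafIso u).1
  have hadjG : ∀ u v, G.Adj u v ↔ ST.Accessible (ST.leafIso u).1 (ST.leafIso v).1 :=
    fun u v => ST.leafIso.map_adj_iff.symm
  have hleft : ∀ u i, i < pos u → ST.InBranch (P i) (P (i + 1)) (ST.leafIso u).1 :=
    fun u i hi => (hpos u i (by have := hpos_le u; omega)).1 hi
  have hright : ∀ u i, i ≤ W.length → pos u ≤ i →
      ST.InBranch (P (i + 1)) (P i) (ST.leafIso u).1 := fun u i hi hui =>
    (GraphLabelledTree.inBranch_or (hadj i hi) _).resolve_left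
      fun hb => absurd ((hpos u i hi).2 hb) (by omega)
  have hmid : ∀ m l, W[m]? = some l →
      (ST.MarkerAdj (P (m + 1)) (P m) (P (m + 2)) ↔ l ≠ Letter.S) := by
    intro m l hl
    have hm := (List.getElem?_eq_some_iff.1 hl).1
    exact (hW m l hl).markerAdj_iff (hadj m hm.le).symm (hadj (m + 1) hm) (hne m hm)
  have hnode : ∀ m < W.length, ST.IsNode (P (m + 1)) := fun m hm =>
    GraphLabelledTree.isNode_of_adj (hadj m hm.le).symm (hadj (m + 1) hm) (hne m hm)
  -- the marker vertex off the path that leads to a given vertex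
  have hbag : ∀ u m, pos u = m + 1 → m < W.length → ∃ w,
      ST.InBranch (P (m + 1)) w (ST.leafIso u).1 ∧ w ≠ P m ∧ w ≠ P (m + 2) := by
    intro u m hu hm
    obtain ⟨w, hw⟩ := GraphLabelledTree.exists_inBranch
      ((hnode m hm).ne_of_isLeaf (ST.leafIso u).2)
    refine ⟨w, hw, ?_, ?_⟩
    · rintro rfl
      exact (hleft u m (by omega)).not_symm hw
    · rintro rfl
      exact (hright u (m + 1) hm (by omega)).not_symm hw
  refine ⟨{
    pos := pos
    left := fun u => ST.AccessibleThrough (P (pos u - 1)) (P (pos u)) (ST.leafIso u).1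
    right := fun u => ST.AccessibleThrough (P (pos u + 1)) (P (pos u)) (ST.leafIso u).1
    pos_le := hpos_le
    pos_eq_zero := ?_, pos_eq_last := ?_, right_first := ?_, left_last := ?_, adj_iff := ?_,
    not_right := ?_, not_left := ?_, left_iff_right := ?_, exists_rep := ?_ }⟩
  · intro u
    constructor
    · intro hu
      have h1 := hright u 0 (Nat.zero_le _) hu.le
      have h2 := h1.eq_of_isLeaf (by rw [hx]; exact (ST.leafIso x).2)
      rw [hx] at h2
      exact ST.leafIso.injective (Subtype.ext h2)
    · rintro rfl
      by_contra hu
      exact (hleft u 0 (by omega)).ne hx.symm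
  · intro u
    constructor
    · intro hu
      have h1 := hleft u W.length (by omega)
      have h2 := h1.eq_of_isLeaf (by rw [hy]; exact (ST.leafIso y).2)
      rw [hy] at h2
      exact ST.leafIso.injective (Subtype.ext h2)
    · rintro rfl
      by_contra hu
      have := hpos_le u
      exact (hright u W.length le_rfl (by omega)).ne hy.symm
  · have h0 : pos x = 0 := by
      by_contra hu
      exact (hleft x 0 (by omega)).ne hx.symm
    rw [h0, ← hx]
    exact GraphLabelledTree.accessibleThrough_self (hadj 0 (Nat.zero_le _)).symm
  · have h0 : pos y = W.length + 1 := by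
      by_contra hu
      have := hpos_le y
      exact (hright y W.length le_rfl (by omega)).ne hy.symm
    rw [h0, ← hy]
    exact GraphLabelledTree.accessibleThrough_self (hadj W.length le_rfl)
  · intro u v huv
    have hv := hpos_le v
    rw [hadjG, GraphLabelledTree.accessible_iff_of_inBranch (hright u (pos u) (by omega) le_rfl)
      (hleft v (pos u) huv)]
    refine and_congr_right fun _ => ?_
    have key : ∀ i, i ≤ pos v - 1 →
        (ST.AccessibleThrough (P i) (P (i + 1)) (ST.leafIso v).1 ↔
          ST.AccessibleThrough (P (pos v - 1)) (P (pos v)) (ST.leafIso v).1 ∧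
          ∀ m, i < m + 1 → m + 1 < pos v → W[m]? ≠ some Letter.S) := by
      intro i hi
      induction hi using Nat.decreasingInduction with
      | self =>
        rw [Nat.sub_add_cancel (by omega)]
        exact ⟨fun h => ⟨h, fun m h1 h2 => by omega⟩, fun h => h.1⟩
      | of_succ k hk ih =>
        obtain ⟨l, hl⟩ : ∃ l, W[k]? = some l := ⟨_, List.getElem?_eq_getElem (by omega)⟩
        rw [GraphLabelledTree.accessibleThrough_step (hadj k (by omega))
          (hleft v (k + 1) (by omega)), ih, hmid k l hl]
        constructor
        · rintro ⟨h1, h2, h3⟩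
          refine ⟨h2, fun m hm1 hm2 => ?_⟩
          rcases Nat.lt_or_ge k m with hkm | hkm
          · exact h3 m (by omega) hm2
          · obtain rfl : k = m := by omega
            rw [hl]
            exact fun he => h1 (Option.some.inj he)
        · rintro ⟨h2, h3⟩
          refine ⟨?_, h2, fun m hm1 hm2 => h3 m (by omega) hm2⟩
          rintro rfl
          exact h3 k (by omega) (by omega) hl
    exact key (pos u) (by omega)
  · intro u m hu hl
    have hm := (List.getElem?_eq_some_iff.1 hl).1
    obtain ⟨w, hw, hwa, hwb⟩ := hbag u m hu hm
    rw [hu, GraphLabelledTree.accessibleThrough_step (hadj (m + 1) hm).symm hw]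
    exact fun h => (hW m _ hl).not_markerAdj_of_sx (hne m hm) hwa h.1
  · intro u m hu hl
    have hm := (List.getElem?_eq_some_iff.1 hl).1
    obtain ⟨w, hw, hwa, hwb⟩ := hbag u m hu hm
    rw [hu, Nat.add_sub_cancel, GraphLabelledTree.accessibleThrough_step (hadj m hm.le) hw]
    exact fun h => (hW m _ hl).not_markerAdj_of_sy (hne m hm) hwb h.1
  · intro u m hu hl
    obtain ⟨l, hl', hl⟩ : ∃ l, (l = Letter.K ∨ l = Letter.S) ∧ W[m]? = some l := by
      rcases hl with hl | hl
      · exact ⟨_, Or.inl rfl, hl⟩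
      · exact ⟨_, Or.inr rfl, hl⟩
    have hm := (List.getElem?_eq_some_iff.1 hl).1
    obtain ⟨w, hw, hwa, hwb⟩ := hbag u m hu hm
    rw [hu, GraphLabelledTree.accessibleThrough_step (hadj (m + 1) hm).symm hw, Nat.add_sub_cancel,
      GraphLabelledTree.accessibleThrough_step (hadj m hm.le) hw,
      (hW m _ hl).markerAdj_iff_markerAdj hl' (hadj m hm.le).symm (hadj (m + 1) hm) hw.adj hwa hwb]
  · intro m l hl
    have hm := (List.getElem?_eq_some_iff.1 hl).1
    obtain ⟨w, hw, hwa, hwb, h1, h2⟩ := (hW m _ hl).exists_marker ST.isReduced (hadj m hm.le).symm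
      (hadj (m + 1) hm) (hne m hm)
    obtain ⟨z, hz, hz'⟩ := GraphLabelledTree.exists_accessibleThrough hc' hw
    obtain ⟨u, hu⟩ := ST.leafIso.surjective ⟨z, hz⟩
    have hu' : (ST.leafIso u).1 = z := by rw [hu]
    have hposu : pos u = m + 1 := by
      have e1 := (hpos u m hm.le).2 (by
        rw [hu']; exact hz'.inBranch.step (hadj m hm.le) hwa.symm)
      have e2 : ¬ m + 1 < pos u := by
        rw [hpos u (m + 1) hm, hu']
        exact fun hb => hwb (hz'.inBranch.unique hb)
      omega
    refine ⟨u, hposu, ?_, ?_⟩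
    · rw [hposu, Nat.add_sub_cancel, hu',
        GraphLabelledTree.accessibleThrough_step (hadj m hm.le) hz'.inBranch, h1]
      exact and_iff_left hz'
    · rw [hposu, hu',
        GraphLabelledTree.accessibleThrough_step (hadj (m + 1) hm).symm hz'.inBranch, h2]
      exact and_iff_left hz'

theorem SplitTree.IsWord.isChain_compatible {ST : SplitTree G N} {x y : V} {W : List Letter}
    (h : ST.IsWord x y W) : W.IsChain Compatible := by
  obtain ⟨P, -, -, hadj, hne, hW⟩ := h.exists_path
  rw [List.isChain_iff_getElem]
  intro m hm
  exact ST.isReduced.compatible (hadj m (by omega)).symm (hadj (m + 1) (by omega))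
    (hadj (m + 2) (by omega)) (hne m (by omega)) (hne (m + 1) (by omega))
    (hW m _ (List.getElem?_eq_getElem (by omega)))
    (hW (m + 1) _ (List.getElem?_eq_getElem (by omega)))

theorem SplitTree.existsUnique_isWord [Finite N] (ST : SplitTree G N) (hc : G.Connected)
    (hDH : IsDistanceHereditary G) {x y : V} (hxy : x ≠ y) : ∃! W, ST.IsWord x y W := by
  obtain ⟨p, hp, -⟩ := ST.isTree.existsUnique_path (ST.leafIso x).1 (ST.leafIso y).1
  have hpos : 0 < p.length := by
    rw [Nat.pos_iff_ne_zero]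
    intro h0
    exact hxy (ST.leafIso.injective (Subtype.ext (SimpleGraph.Walk.eq_of_length_eq_zero h0)))
  have hne : ∀ i, i + 1 < p.length → p.getVert i ≠ p.getVert (i + 2) := by
    intro i hi he
    have := hp.getVert_injOn (by simp; omega) (by simp; omega) he
    omega
  have hnode : ∀ i, i + 1 < p.length → ST.IsNode (p.getVert (i + 1)) := fun i hi =>
    GraphLabelledTree.isNode_of_adj (p.adj_getVert_succ (by omega)).symm
      (p.adj_getVert_succ hi) (hne i hi)
  have hex : ∀ i : Fin (p.length - 1), ∃ l,
      ST.HasLetter (p.getVert i) (p.getVert (i + 1)) (p.getVert (i + 2)) l := fun i =>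
    GraphLabelledTree.exists_hasLetter (ST.isCliqueGraph_or_isStarAt hc hDH (hnode i (by omega)))
  choose f hf using hex
  refine ⟨List.ofFn f, ⟨p, hp, by simp; omega, fun i hi => ?_⟩, ?_⟩
  · rw [List.length_ofFn] at hi
    rw [List.getElem_ofFn]
    exact hf ⟨i, hi⟩
  · rintro W ⟨q, hq, hlen, hW⟩
    obtain rfl := GraphLabelledTree.path_unique hp hq
    refine List.ext_getElem (by simp; omega) fun i h1 h2 => ?_
    rw [List.getElem_ofFn]
    exact (hW i h1).unique ST.isReduced (hf ⟨i, by omega⟩) (hnode i (by omega)) (hne i (by omega))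

/-! ### Words that keep the graph distance hereditary -/

section Modification

variable {V : Type*} {G G' : SimpleGraph V} {x y : V} {W : List Letter}

/-- The two graphs have the same edges except possibly `xy`. -/
def AgreeOff (G G' : SimpleGraph V) (x y : V) : Prop :=
  ∀ u v, s(u, v) ≠ s(x, y) → (G'.Adj u v ↔ G.Adj u v)

theorem agreeOff_sup_edge (G : SimpleGraph V) (x y : V) :
    AgreeOff G (G ⊔ SimpleGraph.edge x y) x y := by
  intro u v h
  rw [SimpleGraph.sup_adj, SimpleGraph.edge_adj]
  refine or_iff_left fun ⟨h1, _⟩ => h ?_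
  rw [Sym2.eq_iff]
  tauto

theorem agreeOff_deleteEdges (G : SimpleGraph V) (x y : V) :
    AgreeOff G (G.deleteEdges {s(x, y)}) x y := by
  intro u v h
  rw [SimpleGraph.deleteEdges_adj, Set.mem_singleton_iff]
  exact and_iff_left h

theorem AgreeOff.adj_iff (h : AgreeOff G G' x y) {u v : V} (hx : u ≠ x) (hy : u ≠ y) :
    G'.Adj u v ↔ G.Adj u v := by
  refine h u v fun he => ?_
  rcases Sym2.eq_iff.1 he with ⟨h1, -⟩ | ⟨h1, -⟩
  · exact hx h1
  · exact hy h1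

theorem IsObstruction.congr {p : ℕ → V} {k : ℕ} {q : V} (ho : IsObstruction G' p k q)
    (h : ∀ u ∈ obstructionSet p k q, ∀ v ∈ obstructionSet p k q, (G'.Adj u v ↔ G.Adj u v)) :
    IsObstruction G p k q := by
  have hp : ∀ i, i ≤ k → p i ∈ obstructionSet p k q := fun i hi => Or.inr ⟨i, hi, rfl⟩
  refine ⟨ho.len, fun i j hij hj => ?_, ?_, ?_⟩
  · rw [← h _ (hp i (by omega)) _ (hp j hj)]
    exact ho.path i j hij hj
  · exact (h _ (Or.inl rfl) _ (hp 0 (Nat.zero_le k))).1 ho.adj_left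
  · exact (h _ (Or.inl rfl) _ (hp k le_rfl)).1 ho.adj_right

/-- An obstruction created by changing the edge `xy` contains both `x` and `y`. -/
theorem IsObstruction.mem_and_mem {p : ℕ → V} {k : ℕ} {q : V} (ho : IsObstruction G' p k q)
    (hG : ObstructionFree G) (h : AgreeOff G G' x y) :
    x ∈ obstructionSet p k q ∧ y ∈ obstructionSet p k q := by
  by_contra hcon
  refine hG p k q (ho.congr fun u hu v hv => h u v fun he => hcon ?_)
  rcases Sym2.eq_iff.1 he with ⟨rfl, rfl⟩ | ⟨rfl, rfl⟩
  · exact ⟨hu, hv⟩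
  · exact ⟨hv, hu⟩

namespace PathStructure

theorem pos_first (PS : PathStructure G x y W) : PS.pos x = 0 := (PS.pos_eq_zero x).2 rfl

theorem pos_last (PS : PathStructure G x y W) : PS.pos y = W.length + 1 := (PS.pos_eq_last y).2 rfl

theorem adj_first_last_iff (PS : PathStructure G x y W) : G.Adj x y ↔ Letter.S ∉ W := by
  rw [PS.adj_iff x y (by rw [PS.pos_first, PS.pos_last]; omega), PS.pos_first, PS.pos_last]
  constructor
  · rintro ⟨-, -, h⟩ hS
    obtain ⟨m, hm⟩ := List.mem_iff_getElem?.1 hS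
    have := (List.getElem?_eq_some_iff.1 hm).1
    exact h m (by omega) (by omega) hm
  · exact fun h => ⟨PS.right_first, PS.left_last, fun m _ _ hm => h (List.mem_of_getElem? hm)⟩

/-- The vertices at a given position form one side of a split. -/
theorem isSplitLike (PS : PathStructure G x y W) (h : AgreeOff G G' x y) {m : ℕ}
    (hm : m < W.length) :
    IsSplitLike G' {u | PS.pos u = m + 1} := by
  intro u hu u' hu' v hv v' hv' huv huv'
  rw [Set.mem_ofPred_eq] at hu hu' hv hv'
  have hne : ∀ w, PS.pos w = m + 1 → w ≠ x ∧ w ≠ y := by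
    intro w hw
    rw [Ne, Ne, ← PS.pos_eq_zero, ← PS.pos_eq_last, hw]
    omega
  rw [h.adj_iff (hne u hu).1 (hne u hu).2] at huv ⊢
  rw [h.adj_iff (hne u' hu').1 (hne u' hu').2] at huv'
  have hopen : PS.left u ∨ PS.right u := by
    rcases Nat.lt_or_gt_of_ne hv with h1 | h1
    · exact Or.inl ((PS.adj_iff v u (hu ▸ h1)).1 huv.symm).2.1
    · exact Or.inr ((PS.adj_iff u v (hu ▸ h1)).1 huv).1
  obtain ⟨l, hl⟩ : ∃ l, W[m]? = some l := ⟨_, List.getElem?_eq_getElem hm⟩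
  rcases Nat.lt_or_gt_of_ne hv' with h1 | h1
  · obtain ⟨a1, a2, a3⟩ := (PS.adj_iff v' u' (hu' ▸ h1)).1 huv'.symm
    refine ((PS.adj_iff v' u (hu ▸ h1)).2 ⟨a1, ?_, by rwa [hu, ← hu']⟩).symm
    cases l with
    | K => exact hopen.elim id (PS.left_iff_right u m hu (Or.inl hl)).2
    | S => exact hopen.elim id (PS.left_iff_right u m hu (Or.inr hl)).2
    | Sx => exact hopen.resolve_right (PS.not_right u m hu hl)
    | Sy => exact absurd a2 (PS.not_left u' m hu' hl)
  · obtain ⟨a1, a2, a3⟩ := (PS.adj_iff u' v' (hu' ▸ h1)).1 huv'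
    refine (PS.adj_iff u v' (hu ▸ h1)).2 ⟨?_, a2, by rwa [hu, ← hu']⟩
    cases l with
    | K => exact hopen.elim (PS.left_iff_right u m hu (Or.inl hl)).1 id
    | S => exact hopen.elim (PS.left_iff_right u m hu (Or.inr hl)).1 id
    | Sx => exact absurd a1 (PS.not_right u' m hu' hl)
    | Sy => exact hopen.resolve_left (PS.not_left u m hu hl)

/-- An obstruction created by changing the edge `xy` has at most one vertex at each position. -/
theorem injOn_pos (PS : PathStructure G x y W) (hG : ObstructionFree G)
    (h : AgreeOff G G' x y) (hxy : x ≠ y) {p : ℕ → V} {k : ℕ} {q : V} (ho : IsObstruction G' p k q) :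
    Set.InjOn PS.pos (obstructionSet p k q) := by
  intro u hu v hv huv
  rcases Nat.eq_zero_or_pos (PS.pos u) with h0 | h0
  · rw [(PS.pos_eq_zero u).1 h0, (PS.pos_eq_zero v).1 (huv ▸ h0)]
  rcases Nat.lt_or_ge W.length (PS.pos u) with h1 | h1
  · have h2 : PS.pos u = W.length + 1 := by have := PS.pos_le u; omega
    rw [(PS.pos_eq_last u).1 h2, (PS.pos_eq_last v).1 (huv ▸ h2)]
  · obtain ⟨m, hm⟩ : ∃ m, PS.pos u = m + 1 := ⟨PS.pos u - 1, by omega⟩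
    rcases ho.subsingleton_or (PS.isSplitLike h (m := m) (by omega)) with hs | hs
    · exact hs ⟨hu, hm⟩ ⟨hv, huv.symm.trans hm⟩
    · obtain ⟨hx, hy⟩ := ho.mem_and_mem hG h
      refine absurd (hs ⟨hx, ?_⟩ ⟨hy, ?_⟩) hxy
      · rw [Set.mem_ofPred_eq, PS.pos_first]; omega
      · rw [Set.mem_ofPred_eq, PS.pos_last]; omega

/-- A vertex of an obstruction whose neighbours all lie at one position would have only one
neighbour in it. -/
theorem not_forall_pos_eq (PS : PathStructure G x y W) (hG : ObstructionFree G)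
    (h : AgreeOff G G' x y) (hxy : x ≠ y)
    {p : ℕ → V} {k : ℕ} {q : V} (ho : IsObstruction G' p k q) {u : V}
    (hu : u ∈ obstructionSet p k q) (hx : u ≠ x) (hy : u ≠ y) {i : ℕ}
    (hi : ∀ v, PS.pos v ≠ PS.pos u → G.Adj u v → PS.pos v = i) : False := by
  have hinj := PS.injOn_pos hG h hxy ho
  obtain ⟨v, hv, w, hw, hvw, huv, huw⟩ := ho.exists_two_neighbors hu
  have key : ∀ v ∈ obstructionSet p k q, G'.Adj u v → PS.pos v = i := fun v hv huv =>
    hi v (fun he => huv.ne (hinj hu hv he.symm)) ((h.adj_iff hx hy).1 huv)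
  exact hvw (hinj hv hw ((key v hv huv).trans (key w hw huw).symm))

/-- If at most two letters are left after the bracketed ones are removed, then changing the edge
`xy` creates no obstruction: such an obstruction would have at most one vertex at each of at most
four positions, as the vertices at a bracketed position have degree at most one in it. -/
theorem obstructionFree_of_bracketed (PS : PathStructure G x y W) (hG : ObstructionFree G)
    (h : AgreeOff G G' x y) (hxy : x ≠ y) {w : List Letter} (hw : w.length ≤ 2) (hW : Bracketed w W) :
    ObstructionFree G' := by
  intro p k q ho
  have hinj := PS.injOn_pos hG h hxy ho
  have hpos : ∀ u, PS.pos u ∈ Finset.range (W.length + 2) := fun u =>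
    Finset.mem_range.2 (Nat.lt_succ_of_le (PS.pos_le u))
  have hne : ∀ u, PS.pos u ≠ 0 → PS.pos u ≠ W.length + 1 → u ≠ x ∧ u ≠ y := fun u h1 h2 =>
    ⟨fun he => h1 ((PS.pos_eq_zero u).2 he), fun he => h2 ((PS.pos_eq_last u).2 he)⟩
  have hSx : W[0]? = some Letter.Sx → ∀ u ∈ obstructionSet p k q, PS.pos u ≠ 1 := by
    intro hl u hu hu1
    have := (List.getElem?_eq_some_iff.1 hl).1
    obtain ⟨h1, h2⟩ := hne u (by omega) (by omega)
    refine PS.not_forall_pos_eq hG h hxy ho hu h1 h2 (i := 0) fun v hv huv => ?_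
    by_contra hv0
    exact PS.not_right u 0 hu1 hl ((PS.adj_iff u v (by omega)).1 huv).1
  have hSy : ∀ n, W.length = n + 1 → W[n]? = some Letter.Sy →
      ∀ u ∈ obstructionSet p k q, PS.pos u ≠ n + 1 := by
    intro n hn hl u hu hu1
    obtain ⟨h1, h2⟩ := hne u (by omega) (by omega)
    refine PS.not_forall_pos_eq hG h hxy ho hu h1 h2 (i := n + 2) fun v hv huv => ?_
    have := PS.pos_le v
    by_contra hv0
    exact PS.not_left u n hu1 hl ((PS.adj_iff v u (by omega)).1 huv.symm).2.1
  obtain ⟨a, b, rfl | rfl, rfl | rfl, hWe⟩ := hW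
  · refine ho.not_injOn (s := Finset.range (W.length + 2)) ?_ (fun u _ => hpos u) hinj
    rw [Finset.card_range, hWe]; simpa using hw
  · have hlen : W.length = w.length + 1 := by simp [hWe]
    refine ho.not_injOn (s := (Finset.range (W.length + 2)).erase (w.length + 1)) ?_
      (fun u hu => Finset.mem_erase.2 ⟨hSy w.length hlen (by simp [hWe]) u hu, hpos u⟩) hinj
    rw [Finset.card_erase_of_mem (Finset.mem_range.2 (by omega)), Finset.card_range]
    omega
  · have hlen : W.length = w.length + 1 := by simp [hWe]
    refine ho.not_injOn (s := (Finset.range (W.length + 2)).erase 1) ?_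
      (fun u hu => Finset.mem_erase.2 ⟨hSx (by simp [hWe]) u hu, hpos u⟩) hinj
    rw [Finset.card_erase_of_mem (Finset.mem_range.2 (by omega)), Finset.card_range]
    omega
  · have hlen : W.length = w.length + 1 + 1 := by simp [hWe]
    refine ho.not_injOn (s := ((Finset.range (W.length + 2)).erase 1).erase (w.length + 2)) ?_
      (fun u hu => Finset.mem_erase.2 ⟨hSy (w.length + 1) hlen (by simp [hWe]) u hu,
        Finset.mem_erase.2 ⟨hSx (by simp [hWe]) u hu, hpos u⟩⟩) hinj
    rw [Finset.card_erase_of_mem (Finset.mem_erase.2 ⟨by omega, Finset.mem_range.2 (by omega)⟩),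
      Finset.card_erase_of_mem (Finset.mem_range.2 (by omega)), Finset.card_range]
    omega

/-- If all letters are bracketed, then `xy` is a bridge. -/
theorem not_connected_of_bracketed_nil (PS : PathStructure G x y W) (hW : Bracketed [] W) :
    ¬ (G.deleteEdges {s(x, y)}).Connected := by
  intro hc
  obtain ⟨a, b, ha, hb, hWe⟩ := hW
  rw [List.append_nil] at hWe
  have hlen : W.length = a.length + b.length := by simp [hWe]
  obtain ⟨p⟩ := hc x y
  obtain ⟨d, -, h1, h2⟩ := p.exists_boundary_dart {u | PS.pos u ≤ a.length}
    (by rw [Set.mem_ofPred_eq, PS.pos_first]; omega)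
    (by rw [Set.mem_ofPred_eq, PS.pos_last]; omega)
  rw [Set.mem_ofPred_eq] at h1 h2
  have hd := d.adj
  rw [SimpleGraph.deleteEdges_adj, Set.mem_singleton_iff] at hd
  obtain ⟨hr, hl, -⟩ := (PS.adj_iff d.fst d.snd (by omega)).1 hd.1
  have e1 : d.fst = x := by
    rw [← PS.pos_eq_zero]
    by_contra h0
    rcases ha with rfl | rfl
    · simp only [List.length_nil] at h1; omega
    · simp only [List.length_cons, List.length_nil] at h1
      exact PS.not_right d.fst 0 (by omega) (by simp [hWe]) hr
  have e2 : d.snd = y := by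
    rw [← PS.pos_eq_last]
    have := PS.pos_le d.snd
    by_contra h0
    rcases hb with rfl | rfl
    · simp only [List.length_nil] at hlen; omega
    · simp only [List.length_cons, List.length_nil] at hlen
      exact PS.not_left d.snd a.length (by omega) (by simp [hWe]) hl
  exact hd.2 (congrArg₂ (fun u v => s(u, v)) e1 e2)

end PathStructure

end Modification

/-! ### Words that destroy distance heredity -/

instance : DecidableEq Letter := fun a b => by
  cases a <;> cases b <;> first
    | exact isTrue rfl
    | exact isFalse (fun h => by cases h)

/-- The letter at a position; the two ends, at positions `0` and `W.length + 1`, have none. -/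
def letterAt (W : List Letter) : ℕ → Option Letter
  | 0 => none
  | m + 1 => W[m]?

/-- Adjacency between vertices at positions `i < j` that are as open as the letters of `W` allow. -/
def WordAdj (W : List Letter) (i j : ℕ) : Prop :=
  letterAt W i ≠ some Letter.Sx ∧ letterAt W j ≠ some Letter.Sy ∧
    ∀ m < j, i < m → letterAt W m ≠ some Letter.S

instance (W : List Letter) (i j : ℕ) : Decidable (WordAdj W i j) := by
  unfold WordAdj; infer_instance

/-- A choice `z` of one vertex at each position, with the adjacencies prescribed by the word. -/
structure IsTransversal {V : Type*} (G : SimpleGraph V) (x y : V) (W : List Letter) (z : ℕ → V) :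
    Prop where
  first : z 0 = x
  last : z (W.length + 1) = y
  ne : ∀ i j, i < j → j ≤ W.length + 1 → z i ≠ z j
  adj_iff : ∀ i j, i < j → j ≤ W.length + 1 → (G.Adj (z i) (z j) ↔ WordAdj W i j)

section Transversal

variable {V : Type*} {G : SimpleGraph V} {x y : V}

theorem PathStructure.exists_isTransversal {W : List Letter} (PS : PathStructure G x y W) :
    ∃ z, IsTransversal G x y W z := by
  have hex : ∀ i, ∃ u, i ≤ W.length + 1 → PS.pos u = i ∧
      (i ≤ W.length → (PS.right u ↔ letterAt W i ≠ some Letter.Sx)) ∧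
      (1 ≤ i → (PS.left u ↔ letterAt W i ≠ some Letter.Sy)) := by
    intro i
    rcases i with _ | m
    · exact ⟨x, fun _ => ⟨PS.pos_first, fun _ => by simp [letterAt, PS.right_first],
        fun h => by omega⟩⟩
    rcases Nat.lt_trichotomy m W.length with hm | rfl | hm
    · obtain ⟨l, hl⟩ : ∃ l, W[m]? = some l := ⟨_, List.getElem?_eq_getElem hm⟩
      obtain ⟨u, h1, h2, h3⟩ := PS.exists_rep m l hl
      exact ⟨u, fun _ => ⟨h1, fun _ => by simp [letterAt, hl, h3],
        fun _ => by simp [letterAt, hl, h2]⟩⟩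
    · exact ⟨y, fun _ => ⟨PS.pos_last, fun h => by omega,
        fun _ => by simp [letterAt, PS.left_last]⟩⟩
    · exact ⟨x, fun h => by omega⟩
  choose z hz using hex
  refine ⟨z, (PS.pos_eq_zero _).1 (hz 0 (by omega)).1, (PS.pos_eq_last _).1 (hz _ le_rfl).1,
    fun i j hij hj he => ?_, fun i j hij hj => ?_⟩
  · have h1 := (hz i (by omega)).1
    rw [he, (hz j hj).1] at h1
    omega
  · obtain ⟨h1, h2, -⟩ := hz i (by omega)
    obtain ⟨h3, -, h4⟩ := hz j hj
    rw [PS.adj_iff _ _ (by omega), h1, h3, h2 (by omega), h4 (by omega)]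
    refine and_congr_right fun _ => and_congr_right fun _ => ⟨fun h m hm1 hm2 => ?_,
      fun h m hm1 hm2 => h (m + 1) hm2 hm1⟩
    obtain ⟨n, rfl⟩ : ∃ n, m = n + 1 := ⟨m - 1, by omega⟩
    exact h n hm2 hm1

/-- Deleting a vertex at a position with a letter other than `S` deletes the letter. -/
theorem IsTransversal.delete {A B : List Letter} {l : Letter} (hl : l ≠ Letter.S) {z : ℕ → V}
    (h : IsTransversal G x y (A ++ l :: B) z) :
    IsTransversal G x y (A ++ B) (fun i => if i ≤ A.length then z i else z (i + 1)) := by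
  let f : ℕ → ℕ := fun i => if i ≤ A.length then i else i + 1
  have hf : (fun i => if i ≤ A.length then z i else z (i + 1)) = fun i => z (f i) := by
    ext i; simp only [f]; split <;> rfl
  have hfi : ∀ i, (i ≤ A.length ∧ f i = i) ∨ (A.length < i ∧ f i = i + 1) := by
    intro i
    simp only [f]
    split
    · exact Or.inl ⟨‹_›, rfl⟩
    · exact Or.inr ⟨by omega, rfl⟩
  have hlet : ∀ i, letterAt (A ++ B) i = letterAt (A ++ l :: B) (f i) := by
    intro i
    rcases i with _ | m
    · simp [f, letterAt]
    · rcases hfi (m + 1) with ⟨h1, h2⟩ | ⟨h1, h2⟩ <;> rw [h2]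
      · simp only [letterAt]
        rw [List.getElem?_append_left (by omega), List.getElem?_append_left (by omega)]
      · simp only [letterAt]
        rw [List.getElem?_append_right (by omega), List.getElem?_append_right (by omega),
          show m + 1 - A.length = (m - A.length) + 1 by omega, List.getElem?_cons_succ]
  have hdel : letterAt (A ++ l :: B) (A.length + 1) = some l := by simp [letterAt]
  have hlen1 : (A ++ l :: B).length = A.length + B.length + 1 := by simp; omega
  have hlen2 : (A ++ B).length = A.length + B.length := by simp
  have hadj : ∀ i j, WordAdj (A ++ B) i j ↔ WordAdj (A ++ l :: B) (f i) (f j) := by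
    intro i j
    unfold WordAdj
    rw [hlet i, hlet j]
    refine and_congr_right fun _ => and_congr_right fun _ => ⟨fun h m hm1 hm2 => ?_,
      fun h m hm1 hm2 => ?_⟩
    · have hi := hfi i
      have hj := hfi j
      rcases Nat.lt_trichotomy m (A.length + 1) with h1 | h1 | h1
      · have := h m (by omega) (by omega)
        rw [hlet] at this
        rcases hfi m with h2 | h2
        · rwa [h2.2] at this
        · omega
      · rw [h1, hdel]
        exact fun he => hl (Option.some.inj he)
      · have := h (m - 1) (by omega) (by omega)
        rw [hlet] at this
        rcases hfi (m - 1) with h2 | h2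
        · omega
        · rwa [h2.2, Nat.sub_add_cancel (by omega)] at this
    · rw [hlet]
      have hi := hfi i
      have hj := hfi j
      have hm := hfi m
      exact h (f m) (by omega) (by omega)
  rw [hf]
  have hlast : f (A.length + B.length + 1) = A.length + B.length + 1 + 1 := by
    have := hfi (A.length + B.length + 1)
    omega
  have hbound : ∀ i j, i < j → j ≤ (A ++ B).length + 1 →
      f i < f j ∧ f j ≤ (A ++ l :: B).length + 1 := by
    intro i j hij hj
    have hi := hfi i
    have hj := hfi j
    omega
  refine ⟨?_, ?_, fun i j hij hj => ?_, fun i j hij hj => ?_⟩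
  · rw [show f 0 = 0 from rfl]; exact h.first
  · rw [hlen2, hlast, ← hlen1]; exact h.last
  · exact h.ne _ _ (hbound i j hij hj).1 (hbound i j hij hj).2
  · rw [hadj]; exact h.adj_iff _ _ (hbound i j hij hj).1 (hbound i j hij hj).2

/-- Letters other than `S` may be dropped from the word of a transversal. -/
theorem IsTransversal.of_sublist {W W' : List Letter} (hs : W'.Sublist W) :
    W'.count Letter.S = W.count Letter.S → ∀ (A : List Letter) (z : ℕ → V),
      IsTransversal G x y (A ++ W) z → ∃ z', IsTransversal G x y (A ++ W') z' := by
  induction hs with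
  | slnil => exact fun _ A z h => ⟨z, h⟩
  | @cons W' W l hs ih =>
    intro hcount A z h
    have hle := hs.count_le Letter.S
    have hl : l ≠ Letter.S := by
      rintro rfl
      rw [List.count_cons_self] at hcount
      omega
    rw [List.count_cons_of_ne hl] at hcount
    exact ih hcount A _ (h.delete hl)
  | @cons_cons W' W l hs ih =>
    intro hcount A z h
    rw [List.count_cons, List.count_cons] at hcount
    have := ih (by omega) (A ++ [l]) z (by simpa using h)
    simpa using this

/-- Adjacency of the positions `i` and `j` after the edge between the ends has been added (`e` is
true) or deleted (`e` is false). -/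
def ModAdj (e : Bool) (W : List Letter) (i j : ℕ) : Prop :=
  if i = 0 ∧ j = W.length + 1 then e = true else WordAdj W i j

instance (e : Bool) (W : List Letter) (i j : ℕ) : Decidable (ModAdj e W i j) := by
  unfold ModAdj; infer_instance

/-- The positions `p 0, …, p k` and `q` form an obstruction after the modification. -/
def IsWordObstruction (e : Bool) (W : List Letter) (p : ℕ → ℕ) (k q : ℕ) : Prop :=
  3 ≤ k ∧ q ≤ W.length + 1 ∧ (∀ i < k + 1, p i ≤ W.length + 1) ∧
    (∀ j < k + 1, ∀ i < j, p i < p j ∧ (ModAdj e W (p i) (p j) ↔ j = i + 1) ∨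
      p j < p i ∧ (ModAdj e W (p j) (p i) ↔ j = i + 1)) ∧
    (q < p 0 ∧ ModAdj e W q (p 0) ∨ p 0 < q ∧ ModAdj e W (p 0) q) ∧
    (q < p k ∧ ModAdj e W q (p k) ∨ p k < q ∧ ModAdj e W (p k) q)

instance (e : Bool) (W : List Letter) (p : ℕ → ℕ) (k q : ℕ) :
    Decidable (IsWordObstruction e W p k q) := by
  unfold IsWordObstruction; infer_instance

theorem IsTransversal.modAdj_iff {G' : SimpleGraph V} (h : AgreeOff G G' x y) {e : Bool}
    (he : G'.Adj x y ↔ e = true) {W : List Letter} {z : ℕ → V} (hz : IsTransversal G x y W z)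
    {i j : ℕ} (hij : i < j) (hj : j ≤ W.length + 1) :
    G'.Adj (z i) (z j) ↔ ModAdj e W i j := by
  unfold ModAdj
  split
  · next hc =>
    obtain ⟨rfl, rfl⟩ := hc
    rw [hz.first, hz.last, he]
  · next hc =>
    rw [← hz.adj_iff i j hij hj]
    refine h _ _ fun heq => ?_
    rw [← hz.first, ← hz.last] at heq
    rcases Sym2.eq_iff.1 heq with ⟨h1, h2⟩ | ⟨h1, h2⟩
    · rcases Nat.eq_zero_or_pos i with h0 | h0
      · refine hz.ne j (W.length + 1) ?_ le_rfl h2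
        omega
      · exact hz.ne 0 i h0 (by omega) h1.symm
    · exact hz.ne 0 j (by omega) hj h2.symm

theorem IsWordObstruction.not_obstructionFree {G' : SimpleGraph V} (h : AgreeOff G G' x y)
    {e : Bool} (he : G'.Adj x y ↔ e = true) {W : List Letter} {z : ℕ → V}
    (hz : IsTransversal G x y W z) {p : ℕ → ℕ} {k q : ℕ} (ho : IsWordObstruction e W p k q) :
    ¬ ObstructionFree G' := by
  obtain ⟨hk, hq, hp, hpath, h0, h1⟩ := ho
  have key : ∀ {i j}, i ≤ W.length + 1 → j ≤ W.length + 1 →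
      (i < j ∧ ModAdj e W i j ∨ j < i ∧ ModAdj e W j i) → G'.Adj (z i) (z j) := by
    rintro i j hi hj (⟨hij, ha⟩ | ⟨hij, ha⟩)
    · exact (hz.modAdj_iff h he hij hj).2 ha
    · exact ((hz.modAdj_iff h he hij hi).2 ha).symm
  refine fun hf => hf (fun i => z (p i)) k (z q) ⟨hk, fun i j hij hj => ?_,
    key hq (hp 0 (by omega)) h0, key hq (hp k (by omega)) h1⟩
  rcases hpath j (by omega) i hij with ⟨hlt, ha⟩ | ⟨hlt, ha⟩
  · exact ⟨hz.ne _ _ hlt (hp j (by omega)), (hz.modAdj_iff h he hlt (hp j (by omega))).trans ha⟩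
  · exact ⟨(hz.ne _ _ hlt (hp i (by omega))).symm, (G'.adj_comm _ _).trans
      ((hz.modAdj_iff h he hlt (hp i (by omega))).trans ha)⟩

/-- `B` is obtained from `W` by dropping letters other than `S`. -/
def IsSubword (B W : List Letter) : Prop :=
  B.Sublist W ∧ B.count Letter.S = W.count Letter.S

theorem PathStructure.not_obstructionFree {G' : SimpleGraph V} {W : List Letter}
    (PS : PathStructure G x y W) (h : AgreeOff G G' x y) {e : Bool} (he : G'.Adj x y ↔ e = true)
    {B : List Letter} (hB : IsSubword B W) {p : ℕ → ℕ} {k q : ℕ}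
    (ho : IsWordObstruction e B p k q) : ¬ ObstructionFree G' := by
  obtain ⟨z, hz⟩ := PS.exists_isTransversal
  obtain ⟨z', hz'⟩ := IsTransversal.of_sublist hB.1 hB.2 [] z hz
  exact ho.not_obstructionFree h he hz'

/-- Three or more letters `S` produce a hole when `xy` is added. -/
theorem isWordObstruction_replicate {n : ℕ} (hn : 3 ≤ n) :
    IsWordObstruction true (List.replicate n Letter.S) id n (n + 1) := by
  have hlet : ∀ i, 0 < i → i ≤ n → letterAt (List.replicate n Letter.S) i = some Letter.S := by
    intro i h0 hi
    obtain ⟨m, rfl⟩ : ∃ m, i = m + 1 := ⟨i - 1, by omega⟩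
    simp only [letterAt]
    rw [List.getElem?_replicate, if_pos (by omega)]
  have hlet' : ∀ i l, l ≠ Letter.S → letterAt (List.replicate n Letter.S) i ≠ some l := by
    intro i l hl he
    rcases i with _ | m
    · simp [letterAt] at he
    · simp only [letterAt, List.getElem?_replicate] at he
      split at he
      · exact hl (Option.some.inj he).symm
      · cases he
  have hadj : ∀ i j, i < j → j ≤ n + 1 →
      (WordAdj (List.replicate n Letter.S) i j ↔ j = i + 1) := by
    intro i j hij hj
    constructor
    · rintro ⟨-, -, h⟩
      by_contra hne
      exact h (i + 1) (by omega) (by omega) (hlet _ (by omega) (by omega))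
    · rintro rfl
      exact ⟨hlet' _ _ (by decide), hlet' _ _ (by decide), fun m h1 h2 => by omega⟩
  refine ⟨hn, by simp, fun i hi => by simp only [id, List.length_replicate]; omega,
    fun j hj i hij => Or.inl ⟨hij, ?_⟩, Or.inr ⟨Nat.succ_pos n, ?_⟩, Or.inr ⟨Nat.lt_succ_self n, ?_⟩⟩
  · simp only [ModAdj, id, List.length_replicate]
    rw [if_neg (by omega), hadj i j hij (by omega)]
  · simp [ModAdj]
  · simp only [ModAdj, id, List.length_replicate]
    rw [if_neg (by omega), hadj n (n + 1) (by omega) le_rfl]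

end Transversal

/-! ### Forbidden subwords of reduced words -/

section Words

open Letter

/-- Subwords that produce a house, a domino or a gem when `xy` is added. -/
def addForbidden : List (List Letter) :=
  [[S, K, S], [S, Sy, Sx, S], [K, S, S], [S, S, K], [Sy, Sx, S, S], [S, S, Sy, Sx], [K, S, K],
    [Sy, K, S], [S, K, Sx], [Sy, Sx, S], [S, Sy, Sx], [K, Sx, S], [S, Sy, K]]

/-- Subwords that produce a house, a domino or a gem when `xy` is deleted. -/
def deleteForbidden : List (List Letter) :=
  [[K, Sx, K], [K, Sy, K], [Sy, Sx, Sy, Sx], [Sy, Sx, K], [K, Sy, Sx], [Sy, K, Sx]]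

theorem exists_isWordObstruction_of_mem_addForbidden {B : List Letter} (h : B ∈ addForbidden) :
    ∃ p k q, IsWordObstruction true B p k q := by
  simp only [addForbidden, List.mem_cons, List.not_mem_nil, or_false] at h
  rcases h with rfl | rfl | rfl | rfl | rfl | rfl | rfl | rfl | rfl | rfl | rfl | rfl | rfl
  · exact ⟨fun i => [0, 4, 3, 2].getD i 0, 3, 1, by decide⟩
  · exact ⟨fun i => [0, 5, 4, 2, 3].getD i 0, 4, 1, by decide⟩
  · exact ⟨fun i => [1, 0, 4, 3].getD i 0, 3, 2, by decide⟩
  · exact ⟨fun i => [0, 1, 2, 3].getD i 0, 3, 4, by decide⟩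
  · exact ⟨fun i => [1, 2, 0, 5, 4].getD i 0, 4, 3, by decide⟩
  · exact ⟨fun i => [0, 1, 2, 4, 3].getD i 0, 4, 5, by decide⟩
  · exact ⟨fun i => [1, 0, 4, 3].getD i 0, 3, 2, by decide⟩
  · exact ⟨fun i => [1, 2, 0, 4].getD i 0, 3, 3, by decide⟩
  · exact ⟨fun i => [0, 4, 2, 3].getD i 0, 3, 1, by decide⟩
  · exact ⟨fun i => [1, 2, 0, 4].getD i 0, 3, 3, by decide⟩
  · exact ⟨fun i => [0, 1, 3, 2].getD i 0, 3, 4, by decide⟩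
  · exact ⟨fun i => [2, 1, 3, 4].getD i 0, 3, 0, by decide⟩
  · exact ⟨fun i => [0, 1, 3, 2].getD i 0, 3, 4, by decide⟩

theorem exists_isWordObstruction_of_mem_deleteForbidden {B : List Letter}
    (h : B ∈ deleteForbidden) : ∃ p k q, IsWordObstruction false B p k q := by
  simp only [deleteForbidden, List.mem_cons, List.not_mem_nil, or_false] at h
  rcases h with rfl | rfl | rfl | rfl | rfl | rfl
  · exact ⟨fun i => [2, 0, 3, 4].getD i 0, 3, 1, by decide⟩
  · exact ⟨fun i => [0, 1, 4, 2].getD i 0, 3, 3, by decide⟩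
  · exact ⟨fun i => [0, 2, 1, 5, 3].getD i 0, 4, 4, by decide⟩
  · exact ⟨fun i => [0, 2, 1, 4].getD i 0, 3, 3, by decide⟩
  · exact ⟨fun i => [0, 1, 4, 2].getD i 0, 3, 3, by decide⟩
  · exact ⟨fun i => [0, 3, 1, 4].getD i 0, 3, 2, by decide⟩

theorem letter_cases {l : Letter} (h : l ≠ S) : l = K ∨ l = Sx ∨ l = Sy := by
  cases l <;> simp at h ⊢

/-- The reduced words without `S` that may precede an `S`. -/
theorem prefix_cases {A : List Letter} (hS : S ∉ A) (hc : (A ++ [S]).IsChain Compatible) :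
    (A = [] ∨ A = [Sx] ∨ A = [K] ∨ A = [Sx, K]) ∨
      [Sy, K].Sublist A ∨ [Sy, Sx].Sublist A ∨ [K, Sx].Sublist A := by
  induction A with
  | nil => exact Or.inl (Or.inl rfl)
  | cons l A ih =>
    rw [List.mem_cons, not_or] at hS
    rcases ih hS.2 (List.IsChain.tail hc) with h | h | h | h
    · rcases letter_cases (Ne.symm hS.1) with rfl | rfl | rfl <;>
        rcases h with rfl | rfl | rfl | rfl <;> simp [Compatible] at hc ⊢
    · exact Or.inr (Or.inl (h.cons l))
    · exact Or.inr (Or.inr (Or.inl (h.cons l)))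
    · exact Or.inr (Or.inr (Or.inr (h.cons l)))

/-- The reduced words without `S` that may follow an `S`. -/
theorem suffix_cases {A : List Letter} (hS : S ∉ A) (hc : (S :: A).IsChain Compatible) :
    (A = [] ∨ A = [Sy] ∨ A = [K] ∨ A = [K, Sy]) ∨
      [K, Sx].Sublist A ∨ [Sy, Sx].Sublist A ∨ [Sy, K].Sublist A := by
  induction A using List.reverseRecOn with
  | nil => exact Or.inl (Or.inl rfl)
  | append_singleton A l ih =>
    rw [List.mem_append, List.mem_singleton, not_or] at hS
    rcases ih hS.1 (List.IsChain.left_of_append (l₂ := [l]) hc) with h | h | h | h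
    · rcases letter_cases (Ne.symm hS.2) with rfl | rfl | rfl <;>
        rcases h with rfl | rfl | rfl | rfl <;> simp [Compatible] at hc ⊢
    · exact Or.inr (Or.inl (h.trans (List.sublist_append_left A _)))
    · exact Or.inr (Or.inr (Or.inl (h.trans (List.sublist_append_left A _))))
    · exact Or.inr (Or.inr (Or.inr (h.trans (List.sublist_append_left A _))))

theorem isSubword_append_cons {A B A' B' : List Letter} (hA : A'.Sublist A) (hSA : S ∉ A)
    (hB : IsSubword B' B) : IsSubword (A' ++ S :: B') (A ++ S :: B) := by
  refine ⟨hA.append (hB.1.cons_cons S), ?_⟩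
  have h1 : A.count S = 0 := List.count_eq_zero.2 hSA
  have h2 : A'.count S = 0 := List.count_eq_zero.2 fun h => hSA (hA.subset h)
  rw [List.count_append, List.count_append, List.count_cons_self, List.count_cons_self, h1, h2,
    hB.2]

theorem isSubword_of_notMem {A A' : List Letter} (hA : A'.Sublist A) (hSA : S ∉ A) :
    IsSubword A' A :=
  ⟨hA, by rw [List.count_eq_zero.2 hSA, List.count_eq_zero.2 fun h => hSA (hA.subset h)]⟩

/-- A reduced word with a single `S` splits into a prefix and a suffix without `S`, to which
`prefix_cases` and `suffix_cases` apply. -/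
theorem one_star_cases {A B : List Letter} (hA : S ∉ A) (hB : S ∉ B)
    (hc : (A ++ S :: B).IsChain Compatible) :
    (∃ F ∈ addForbidden, IsSubword F (A ++ S :: B)) ∨ Bracketed [S, K] (A ++ S :: B) ∨
      Bracketed [K, S] (A ++ S :: B) ∨ Bracketed [S] (A ++ S :: B) := by
  rw [List.isChain_split] at hc
  have key : ∀ A' B' : List Letter, A'.Sublist A → B'.Sublist B → A' ++ S :: B' ∈ addForbidden →
      ∃ F ∈ addForbidden, IsSubword F (A ++ S :: B) := fun A' B' h1 h2 h3 =>
    ⟨_, h3, isSubword_append_cons h1 hA (isSubword_of_notMem h2 hB)⟩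
  rcases prefix_cases hA hc.1 with h1 | h1 | h1 | h1
  · rcases suffix_cases hB hc.2 with h2 | h2 | h2 | h2
    · rcases h1 with rfl | rfl | rfl | rfl <;> rcases h2 with rfl | rfl | rfl | rfl
      case inr.inr.inl.inr.inr.inl => exact Or.inl (key [K] [K] (by simp) (by simp) (by decide))
      case inr.inr.inl.inr.inr.inr => exact Or.inl (key [K] [K] (by simp) (by simp) (by decide))
      case inr.inr.inr.inr.inr.inl => exact Or.inl (key [K] [K] (by simp) (by simp) (by decide))
      case inr.inr.inr.inr.inr.inr => exact Or.inl (key [K] [K] (by simp) (by simp) (by decide))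
      all_goals
        right
        simp [Bracketed]
    · exact Or.inl (key [] _ (List.nil_sublist _) h2 (by decide))
    · exact Or.inl (key [] _ (List.nil_sublist _) h2 (by decide))
    · exact Or.inl (key [] _ (List.nil_sublist _) h2 (by decide))
  · exact Or.inl (key _ [] h1 (List.nil_sublist _) (by decide))
  · exact Or.inl (key _ [] h1 (List.nil_sublist _) (by decide))
  · exact Or.inl (key _ [] h1 (List.nil_sublist _) (by decide))

/-- In a reduced word with exactly two letters `S`, the part between them must be empty: otherwise
it contains `K` or the subword `S_y S_x`. -/
theorem two_star_cases {A B C : List Letter} (hA : S ∉ A) (hB : S ∉ B) (hC : S ∉ C)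
    (hc : (A ++ S :: (B ++ S :: C)).IsChain Compatible) :
    (∃ F ∈ addForbidden, IsSubword F (A ++ S :: (B ++ S :: C))) ∨
      Bracketed [S, S] (A ++ S :: (B ++ S :: C)) := by
  rw [List.isChain_split, List.isChain_cons_split] at hc
  obtain ⟨hcA, hcB, hcC⟩ := hc
  have key : ∀ A' B' C' : List Letter, A'.Sublist A → B'.Sublist B → C'.Sublist C →
      A' ++ S :: (B' ++ S :: C') ∈ addForbidden →
      ∃ F ∈ addForbidden, IsSubword F (A ++ S :: (B ++ S :: C)) := fun A' B' C' h1 h2 h3 h4 =>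
    ⟨_, h4, isSubword_append_cons h1 hA
      (isSubword_append_cons h2 hB (isSubword_of_notMem h3 hC))⟩
  have sub : ∀ {l l' : Letter} {D : List Letter}, [l, l'].Sublist D →
      [l].Sublist D ∧ [l'].Sublist D := fun h =>
    ⟨(List.sublist_append_left [_] [_]).trans h, (List.sublist_append_right [_] [_]).trans h⟩
  have kA : ∀ A', A'.Sublist A → A' ++ [S, S] ∈ addForbidden →
      ∃ F ∈ addForbidden, IsSubword F (A ++ S :: (B ++ S :: C)) := fun A' h h' =>
    key A' [] [] h (List.nil_sublist _) (List.nil_sublist _) h'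
  have kB : ∀ B', B'.Sublist B → S :: (B' ++ [S]) ∈ addForbidden →
      ∃ F ∈ addForbidden, IsSubword F (A ++ S :: (B ++ S :: C)) := fun B' h h' =>
    key [] B' [] (List.nil_sublist _) h (List.nil_sublist _) h'
  have kC : ∀ C', C'.Sublist C → S :: S :: C' ∈ addForbidden →
      ∃ F ∈ addForbidden, IsSubword F (A ++ S :: (B ++ S :: C)) := fun C' h h' =>
    key [] [] C' (List.nil_sublist _) (List.nil_sublist _) h h'
  rcases suffix_cases hB (List.IsChain.left_of_append (l₂ := [S]) hcB) with h | h | h | h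
  · rcases h with rfl | rfl | rfl | rfl
    · rcases prefix_cases hA hcA with (rfl | rfl | rfl | rfl) | h | h | h
      · rcases suffix_cases hC hcC with (rfl | rfl | rfl | rfl) | h | h | h
        · exact Or.inr (by simp [Bracketed])
        · exact Or.inr (by simp [Bracketed])
        · exact Or.inl (kC [K] (by simp) (by decide))
        · exact Or.inl (kC [K] (by simp) (by decide))
        · exact Or.inl (kC _ (sub h).1 (by decide))
        · exact Or.inl (kC _ h (by decide))
        · exact Or.inl (kC _ (sub h).2 (by decide))
      · rcases suffix_cases hC hcC with (rfl | rfl | rfl | rfl) | h | h | h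
        · exact Or.inr (by simp [Bracketed])
        · exact Or.inr (by simp [Bracketed])
        · exact Or.inl (kC [K] (by simp) (by decide))
        · exact Or.inl (kC [K] (by simp) (by decide))
        · exact Or.inl (kC _ (sub h).1 (by decide))
        · exact Or.inl (kC _ h (by decide))
        · exact Or.inl (kC _ (sub h).2 (by decide))
      · exact Or.inl (kA [K] (by simp) (by decide))
      · exact Or.inl (kA [K] (by simp) (by decide))
      · exact Or.inl (kA _ (sub h).2 (by decide))
      · exact Or.inl (kA _ h (by decide))
      · exact Or.inl (kA _ (sub h).1 (by decide))
    · simp [Compatible] at hcB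
    · exact Or.inl (kB [K] (by simp) (by decide))
    · exact Or.inl (kB [K] (by simp) (by decide))
  · exact Or.inl (kB _ (sub h).1 (by decide))
  · exact Or.inl (kB _ h (by decide))
  · exact Or.inl (kB _ (sub h).2 (by decide))

/-- A reduced word containing `S` has three letters `S`, has a forbidden subword, or is one of the
words for which adding `xy` keeps the graph distance hereditary. -/
theorem add_cases {W : List Letter} (hS : S ∈ W) (hc : W.IsChain Compatible) :
    3 ≤ W.count S ∨ (∃ F ∈ addForbidden, IsSubword F W) ∨
      Bracketed [S, S] W ∨ Bracketed [S, K] W ∨ Bracketed [K, S] W ∨ Bracketed [S] W := by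
  obtain ⟨A, B, rfl, hA⟩ := List.eq_append_cons_of_mem hS
  by_cases hB : S ∈ B
  · obtain ⟨B, C, rfl, hB'⟩ := List.eq_append_cons_of_mem hB
    by_cases hC : S ∈ C
    · left
      have := List.count_pos_iff.2 hC
      rw [List.count_append, List.count_cons_self, List.count_append, List.count_cons_self]
      omega
    · exact Or.inr ((two_star_cases hA hB' hC hc).imp_right Or.inl)
  · exact Or.inr ((one_star_cases hA hB hc).imp_right Or.inr)

/-- The words for which deleting `xy` keeps the graph distance hereditary. -/
def deleteWords : List (List Letter) :=
  [[Sy, Sx], [Sy, K], [K, Sx], [K], []].flatMap fun w => [w, Sx :: w, w ++ [Sy], Sx :: w ++ [Sy]]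

/-- A reduced word without `S` has a forbidden subword or is one of the words for which deleting
`xy` keeps the graph distance hereditary. Prefixing a letter to one of these twenty words gives
another one, a word that is not reduced, or a word with a forbidden subword. -/
theorem delete_cases {W : List Letter} (hS : S ∉ W) (hc : W.IsChain Compatible) :
    W ∈ deleteWords ∨ ∃ F ∈ deleteForbidden, F.Sublist W := by
  induction W with
  | nil => exact Or.inl (by decide)
  | cons l W ih =>
    rw [List.mem_cons, not_or] at hS
    rcases ih hS.2 hc.tail with h | ⟨F, hF, hF'⟩
    · have hcheck : ∀ W ∈ deleteWords, ∀ l ∈ [K, Sx, Sy],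
          l :: W ∈ deleteWords ∨ (∃ F ∈ deleteForbidden, F.Sublist (l :: W)) ∨
            ∃ l' ∈ W.head?, [l, l'] ∈ [[K, K], [Sx, Sx], [Sy, Sy]] := by
        decide
      rcases hcheck W h l (by simpa using letter_cases (Ne.symm hS.1)) with h1 | h1 | ⟨l', h1, h2⟩
      · exact Or.inl h1
      · exact Or.inr h1
      · have := hc.rel_head? h1
        simp only [List.mem_cons, List.cons.injEq, and_true, List.not_mem_nil, or_false] at h2
        rcases h2 with ⟨rfl, rfl⟩ | ⟨rfl, rfl⟩ | ⟨rfl, rfl⟩ <;> exact this.elim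
    · exact Or.inr ⟨F, hF, hF'.cons l⟩

theorem bracketed_of_mem_deleteWords {W : List Letter} (h : W ∈ deleteWords) :
    Bracketed [Sy, Sx] W ∨ Bracketed [Sy, K] W ∨ Bracketed [K, Sx] W ∨ Bracketed [K] W ∨
      Bracketed [] W := by
  have key : ∀ w, W ∈ [w, Sx :: w, w ++ [Sy], Sx :: w ++ [Sy]] → Bracketed w W := by
    intro w hw
    simp only [List.mem_cons, List.not_mem_nil, or_false] at hw
    rcases hw with rfl | rfl | rfl | rfl <;> simp [Bracketed]
  obtain ⟨w, hw, hw'⟩ := List.mem_flatMap.1 h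
  have := key w hw'
  simp only [List.mem_cons, List.not_mem_nil, or_false] at hw
  rcases hw with rfl | rfl | rfl | rfl | rfl <;> tauto

end Words

end SplitTreeDH

/-! ### Adding and deleting an edge -/

theorem mainTheorem2 {V : Type*} [Finite V] {N : Type*} [Finite N] (G : SimpleGraph V)
    (hconn : G.Connected) (hDH : SplitTreeDH.IsDistanceHereditary G)
    (ST : SplitTreeDH.SplitTree G N) (x y : V) (hxy : x ≠ y) :
    (∃! W : List SplitTreeDH.Letter, ST.IsWord x y W) ∧
    ∀ W : List SplitTreeDH.Letter, ST.IsWord x y W →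
      (¬ G.Adj x y →
        (SplitTreeDH.IsDistanceHereditary (G ⊔ SimpleGraph.edge x y) ↔
          SplitTreeDH.Bracketed [SplitTreeDH.Letter.S, SplitTreeDH.Letter.S] W ∨
          SplitTreeDH.Bracketed [SplitTreeDH.Letter.S, SplitTreeDH.Letter.K] W ∨
          SplitTreeDH.Bracketed [SplitTreeDH.Letter.K, SplitTreeDH.Letter.S] W ∨
          SplitTreeDH.Bracketed [SplitTreeDH.Letter.S] W)) ∧
      (G.Adj x y →
        (SplitTreeDH.IsDistanceHereditary (G.deleteEdges {s(x, y)}) ↔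
          SplitTreeDH.Bracketed [SplitTreeDH.Letter.Sy, SplitTreeDH.Letter.Sx] W ∨
          SplitTreeDH.Bracketed [SplitTreeDH.Letter.Sy, SplitTreeDH.Letter.K] W ∨
          SplitTreeDH.Bracketed [SplitTreeDH.Letter.K, SplitTreeDH.Letter.Sx] W ∨
          SplitTreeDH.Bracketed [SplitTreeDH.Letter.K] W ∨
          SplitTreeDH.Bracketed [] W) ∧
        (SplitTreeDH.Bracketed [] W → ¬ (G.deleteEdges {s(x, y)}).Connected)) := by
  refine ⟨ST.existsUnique_isWord hconn hDH hxy, fun W hW => ?_⟩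
  obtain ⟨PS⟩ := hW.nonempty_pathStructure hconn
  have hc := hW.isChain_compatible
  rw [SplitTreeDH.isDistanceHereditary_iff] at hDH
  refine ⟨fun hadj => ?_, fun hadj => ⟨?_, PS.not_connected_of_bracketed_nil⟩⟩
  · have hagree := SplitTreeDH.agreeOff_sup_edge G x y
    rw [SplitTreeDH.isDistanceHereditary_iff]
    constructor
    · intro hfree
      have he : (G ⊔ SimpleGraph.edge x y).Adj x y ↔ true = true := by
        simp [SimpleGraph.edge_adj, hxy]
      have hS : SplitTreeDH.Letter.S ∈ W := by
        by_contra h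
        exact hadj (PS.adj_first_last_iff.2 h)
      rcases SplitTreeDH.add_cases hS hc with h | ⟨F, hF, hsub⟩ | h
      · refine absurd hfree (PS.not_obstructionFree hagree he ⟨?_, ?_⟩
          (SplitTreeDH.isWordObstruction_replicate h))
        · exact List.replicate_sublist_iff.2 le_rfl
        · exact List.count_replicate_self
      · obtain ⟨p, k, q, ho⟩ := SplitTreeDH.exists_isWordObstruction_of_mem_addForbidden hF
        exact absurd hfree (PS.not_obstructionFree hagree he hsub ho)
      · exact h
    · rintro (h | h | h | h) <;>
        exact PS.obstructionFree_of_bracketed hDH hagree hxy (by simp) h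
  · have hagree := SplitTreeDH.agreeOff_deleteEdges G x y
    rw [SplitTreeDH.isDistanceHereditary_iff]
    constructor
    · intro hfree
      have he : (G.deleteEdges {s(x, y)}).Adj x y ↔ false = true := by simp
      have hS := PS.adj_first_last_iff.1 hadj
      rcases SplitTreeDH.delete_cases hS hc with h | ⟨F, hF, hsub⟩
      · exact SplitTreeDH.bracketed_of_mem_deleteWords h
      · obtain ⟨p, k, q, ho⟩ := SplitTreeDH.exists_isWordObstruction_of_mem_deleteForbidden hF
        exact absurd hfree (PS.not_obstructionFree hagree he
          (SplitTreeDH.isSubword_of_notMem hsub hS) ho)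
    · rintro (h | h | h | h | h) <;>
        exact PS.obstructionFree_of_bracketed hDH hagree hxy (by simp) h
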